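/- **Definitions.** An algebra is a nonempty set with finitary operations; a variety is the class of all algebras of a fixed language that satisfy a given set of identities. Two congruences $\theta,\theta^*$ of an algebra $A$ are complementary factor congruences if $\theta\cap\theta^*$ is the identity relation and $\theta\circ\theta^*=A\times A$; a factor congruence is a congruence that has such a complement. A variety $\mathcal V$ has Boolean factor congruences (BFC) if for every $A\in\mathcal V$ the set of factor congruences of $A$ is a distributive sublattice of the congruence lattice of $A$. Let $n\ge 0$ and, for $1\le i\le n$, let $s_i,t_i$ be $(2i+2)$-ary terms. For a tuple $v=(a,b,c,d,a_1,b_1,\dots,a_n,b_n)$ of elements of an algebra define tuples $(x,y,z,w,x_1,y_1,\dots,x_n,y_n)$ by recursion on $j$ as follows. - $\sigma(v)$: $x=a,\ y=b,\ z=a,\ w=b$, $\ x_j=s_j(x,y,z,w,x_1,y_1,\dots,x_{j-1},y_{j-1})$, $\ y_j=b_j$. - $\sigma^*(v)$: $x=a,\ y=a,\ z=c,\ w=d$, $\ x_j=t_j(x,y,z,w,x_1,y_1,\dots,x_{j-1},y_{j-1})$, $\ y_j=b_j$. - $\rho(v)$: $x=a,\ y=b,\ z=c,\ w=c$, $\ x_j=a_j$,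 $\ y_j=s_j(x,y,z,w,x_1,y_1,\dots,x_{j-1},y_{j-1})$. - $\rho^*(v)$: $x=a,\ y=b,\ z=c,\ w=d$, $\ x_j=a_j$, $\ y_j=t_j(x,y,z,w,x_1,y_1,\dots,x_{j-1},y_{j-1})$. Let $\vec X=(x,y,z,w,x_1,y_1,\dots,x_n,y_n)$ be a tuple of distinct variables, and apply these maps to $\vec X$ in the term algebra $T(\vec X)$. Write $|\alpha|$ for the length of a word $\alpha$ and $\varepsilon$ for the empty word. **Theorem.** A variety $\mathcal V$ has BFC if and only if there exist integers $N=2k$ with $k\ge 1$ and $n\ge 0$, $(2i+2)$-ary terms $s_i,t_i$ for $i=1,\dots,n$, and, for every word $\alpha$ of length at most $N$ over the alphabet $\{1,\dots,N\}$, terms $L_\alpha,R_\alpha$ in the variables $\vec X$, such that the following identities hold in $\mathcal V$. 1. For every $\alpha$ with $|\alpha|=N$: $L_\alpha(\rho(\vec X))\approx R_\alpha(\rho(\vec X))$ and $L_\alpha(\rho^*(\vec X))\approx R_\alpha(\rho^*(\vec X))$. 2. For the empty word: $x\approx L_\varepsilon(\vec X)$; $y\approx R_\varepsilon(\vec X)$;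 $L_\varepsilon(\rho(\vec X))\approx L_1(\rho(\vec X))$; $R_j(\rho(\vec X))\approx L_{j+1}(\rho(\vec X))$ for $1\le j\le N-1$; $R_N(\rho(\vec X))\approx R_\varepsilon(\rho(\vec X))$. 3. For every $\alpha$ with $0<|\alpha|<N$ and $|\alpha|$ even: - $L_\alpha(\rho(\vec X))\approx L_{\alpha1}(\rho(\vec X))$; $R_{\alpha j}(\rho(\vec X))\approx L_{\alpha(j+1)}(\rho(\vec X))$ for $1\le j\le k-1$; $R_{\alpha k}(\rho(\vec X))\approx R_\alpha(\rho(\vec X))$; - $L_\alpha(\rho^*(\vec X))\approx L_{\alpha(k+1)}(\rho^*(\vec X))$; $R_{\alpha j}(\rho^*(\vec X))\approx L_{\alpha(j+1)}(\rho^*(\vec X))$ for $k+1\le j\le N-1$; $R_{\alpha N}(\rho^*(\vec X))\approx R_\alpha(\rho^*(\vec X))$. 4. For every $\alpha$ with $0<|\alpha|<N$ and $|\alpha|$ odd: - $L_\alpha(\sigma(\vec X))\approx L_{\alpha1}(\sigma(\vec X))$; $R_{\alpha j}(\sigma(\vec X))\approx L_{\alpha(j+1)}(\sigma(\vec X))$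 for $1\le j\le k-1$; $R_{\alpha k}(\sigma(\vec X))\approx R_\alpha(\sigma(\vec X))$; - $L_\alpha(\sigma^*(\vec X))\approx L_{\alpha(k+1)}(\sigma^*(\vec X))$; $R_{\alpha j}(\sigma^*(\vec X))\approx L_{\alpha(j+1)}(\sigma^*(\vec X))$ for $k+1\le j\le N-1$; $R_{\alpha N}(\sigma^*(\vec X))\approx R_\alpha(\sigma^*(\vec X))$. -/

import Mathlib

universe u v w

namespace BFC

/-! ### Varieties -/

section Variety

/-- A variety over the language `L`, presented by a set of identities `p ≈ q` between terms in
countably many variables. -/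
structure Variety (L : FirstOrder.Language.{u, v}) where
  identities : Set (L.Term ℕ × L.Term ℕ)

variable {L : FirstOrder.Language.{u, v}}

/-- The algebra `A` satisfies the identity `p ≈ q`. -/
def Satisfies {α : Type*} (A : Type*) [L.Structure A] (p q : L.Term α) : Prop :=
  ∀ e : α → A, p.realize e = q.realize e

/-- `A` is an algebra of the variety `V`: a nonempty `L`-algebra satisfying all the defining
identities. -/
def Variety.Mem (V : Variety L) (A : Type*) [L.Structure A] : Prop :=
  Nonempty A ∧ ∀ e ∈ V.identities, Satisfies A e.1 e.2

/-- The identity `p ≈ q` holds in the variety `V`, that is, in each of its algebras (of universe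
`max u w`, where `u` is the universe of the operation symbols). -/
def Variety.Models (V : Variety L) {α : Type*} (p q : L.Term α) : Prop :=
  ∀ (A : Type (max u w)) [L.Structure A], V.Mem A → Satisfies A p q

end Variety

/-! ### Congruences -/

section Congruence

/-- A congruence of the algebra `A`: an equivalence relation compatible with all operations. -/
structure Cong (L : FirstOrder.Language.{u, v}) (A : Type*) [L.Structure A] extends Setoid A where
  funMap_rel : ∀ (n : ℕ) (f : L.Functions n) (a b : Fin n → A),
    (∀ i, r (a i) (b i)) →
      r (FirstOrder.Language.Structure.funMap f a) (FirstOrder.Language.Structure.funMap f b)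

namespace Cong

variable {L : FirstOrder.Language.{u, v}} {A : Type*} [L.Structure A]

theorem toSetoid_injective : Function.Injective (toSetoid : Cong L A → Setoid A) := by
  rintro ⟨s, hs⟩ ⟨t, ht⟩ h
  cases h
  rfl

/-- Congruences are ordered by inclusion. -/
instance : PartialOrder (Cong L A) := PartialOrder.lift toSetoid toSetoid_injective

theorem le_def {θ φ : Cong L A} : θ ≤ φ ↔ ∀ a b, θ.r a b → φ.r a b :=
  ⟨fun h _ _ hab => h hab, fun h _ _ hab => h _ _ hab⟩

instance : InfSet (Cong L A) where
  sInf S :=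
    { r := fun a b => ∀ θ ∈ S, θ.r a b
      iseqv :=
        ⟨fun a θ _ => θ.iseqv.refl a, fun h θ hθ => θ.iseqv.symm (h θ hθ),
          fun h h' θ hθ => θ.iseqv.trans (h θ hθ) (h' θ hθ)⟩
      funMap_rel := fun n f a b h θ hθ => θ.funMap_rel n f a b fun i => h i θ hθ }

theorem isGLB_sInf (S : Set (Cong L A)) : IsGLB S (sInf S) :=
  ⟨fun θ hθ => le_def.2 fun _ _ h => h θ hθ,
    fun _ hφ => le_def.2 fun _ _ h _ hθ => le_def.1 (hφ hθ) _ _ h⟩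

/-- The congruence lattice of `A`. -/
instance : CompleteLattice (Cong L A) where
  __ := completeLatticeOfInf (Cong L A) isGLB_sInf
  inf θ φ :=
    { r := fun a b => θ.r a b ∧ φ.r a b
      iseqv :=
        ⟨fun a => ⟨θ.iseqv.refl a, φ.iseqv.refl a⟩,
          fun h => ⟨θ.iseqv.symm h.1, φ.iseqv.symm h.2⟩,
          fun h h' => ⟨θ.iseqv.trans h.1 h'.1, φ.iseqv.trans h.2 h'.2⟩⟩
      funMap_rel := fun n f a b h =>
        ⟨θ.funMap_rel n f a b fun i => (h i).1, φ.funMap_rel n f a b fun i => (h i).2⟩ }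
  inf_le_left _ _ := le_def.2 fun _ _ h => h.1
  inf_le_right _ _ := le_def.2 fun _ _ h => h.2
  le_inf _ _ _ h h' := le_def.2 fun _ _ hab => ⟨le_def.1 h _ _ hab, le_def.1 h' _ _ hab⟩
  bot :=
    { r := fun a b => a = b
      iseqv := eq_equivalence
      funMap_rel := fun _ _ _ _ h => congrArg _ (funext h) }
  bot_le θ := le_def.2 fun a _ h => h ▸ θ.iseqv.refl a
  top :=
    { r := fun _ _ => True
      iseqv := ⟨fun _ => trivial, fun _ => trivial, fun _ _ => trivial⟩
      funMap_rel := fun _ _ _ _ _ => trivial }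
  le_top _ := le_def.2 fun _ _ _ => trivial

/-- `θ` and `θ'` are complementary factor congruences: they intersect in the identity relation and
their relational product is the universal relation. -/
def Complementary (θ θ' : Cong L A) : Prop :=
  θ ⊓ θ' = ⊥ ∧ ∀ a b, ∃ c, θ.r a c ∧ θ'.r c b

/-- `θ` is a factor congruence. -/
def IsFactor (θ : Cong L A) : Prop := ∃ θ' : Cong L A, Complementary θ θ'

end Cong

end Congruence

/-! ### Boolean factor congruences -/

section HasBFC

/-- The variety `V` has Boolean factor congruences: in each algebra `A` of `V`, the factor
congruences form a distributive sublattice of the congruence lattice of `A`. -/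
def HasBFC {L : FirstOrder.Language.{u, v}} (V : Variety L) : Prop :=
  ∀ (A : Type (max u w)) [L.Structure A], V.Mem A →
    ∃ S : Sublattice (Cong L A), (S : Set (Cong L A)) = {θ | θ.IsFactor} ∧
      ∀ θ ∈ S, ∀ φ ∈ S, ∀ ψ ∈ S, θ ⊓ (φ ⊔ ψ) = (θ ⊓ φ) ⊔ (θ ⊓ ψ)

end HasBFC

/-! ### The maps `σ`, `σ*`, `ρ`, `ρ*` -/

section Maps

/-- Indices of the `4 + 2n` entries of a tuple `(x, y, z, w, x₁, y₁, …, xₙ, yₙ)`. The indices `i`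
of `xs i` and `ys i` start at `0`: the entries `xs i`, `ys i` are `xᵢ₊₁`, `yᵢ₊₁`. -/
inductive Var (n : ℕ) : Type
  | x | y | z | w
  | xs (i : Fin n)
  | ys (i : Fin n)

variable {L : FirstOrder.Language.{u, v}} {A : Type*} [L.Structure A] {n : ℕ}

/-- The tuple with the entries `a, b, c, d, p₁, q₁, …, pₙ, qₙ`. -/
def mkTuple (a b c d : A) (p q : Fin n → A) : Var n → A
  | .x => a
  | .y => b
  | .z => c
  | .w => d
  | .xs i => p i
  | .ys i => q i

/-- Given `x, y, z, w` and `y₁, …, yₙ`, the elements `x₁, …, xₙ` defined by the recursion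
`xⱼ := sⱼ(x, y, z, w, x₁, y₁, …, xⱼ₋₁, yⱼ₋₁)`. -/
def recX (s : (i : Fin n) → L.Term (Var i)) (x y z w : A) (ys : Fin n → A) (j : Fin n) : A :=
  (s j).realize (mkTuple x y z w
    (fun i => recX s x y z w ys (i.castLE j.isLt.le)) (fun i => ys (i.castLE j.isLt.le)))
termination_by j.val
decreasing_by exact i.isLt

/-- Given `x, y, z, w` and `x₁, …, xₙ`, the elements `y₁, …, yₙ` defined by the recursion
`yⱼ := sⱼ(x, y, z, w, x₁, y₁, …, xⱼ₋₁, yⱼ₋₁)`. -/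
def recY (s : (i : Fin n) → L.Term (Var i)) (x y z w : A) (xs : Fin n → A) (j : Fin n) : A :=
  (s j).realize (mkTuple x y z w
    (fun i => xs (i.castLE j.isLt.le)) (fun i => recY s x y z w xs (i.castLE j.isLt.le)))
termination_by j.val
decreasing_by exact i.isLt

/-- `σ(a, b, c, d, a₁, b₁, …)` has `(x, y, z, w) = (a, b, a, b)`, `yⱼ = bⱼ` and
`xⱼ = sⱼ(x, y, z, w, x₁, y₁, …, xⱼ₋₁, yⱼ₋₁)`. -/
def sigma (s : (i : Fin n) → L.Term (Var i)) (v : Var n → A) : Var n → A :=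
  mkTuple (v .x) (v .y) (v .x) (v .y)
    (recX s (v .x) (v .y) (v .x) (v .y) fun i => v (.ys i)) (fun i => v (.ys i))

/-- `σ*(a, b, c, d, a₁, b₁, …)` has `(x, y, z, w) = (a, a, c, d)`, `yⱼ = bⱼ` and
`xⱼ = tⱼ(x, y, z, w, x₁, y₁, …, xⱼ₋₁, yⱼ₋₁)`. -/
def sigmaStar (t : (i : Fin n) → L.Term (Var i)) (v : Var n → A) : Var n → A :=
  mkTuple (v .x) (v .x) (v .z) (v .w)
    (recX t (v .x) (v .x) (v .z) (v .w) fun i => v (.ys i)) (fun i => v (.ys i))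

/-- `ρ(a, b, c, d, a₁, b₁, …)` has `(x, y, z, w) = (a, b, c, c)`, `xⱼ = aⱼ` and
`yⱼ = sⱼ(x, y, z, w, x₁, y₁, …, xⱼ₋₁, yⱼ₋₁)`. -/
def rho (s : (i : Fin n) → L.Term (Var i)) (v : Var n → A) : Var n → A :=
  mkTuple (v .x) (v .y) (v .z) (v .z)
    (fun i => v (.xs i)) (recY s (v .x) (v .y) (v .z) (v .z) fun i => v (.xs i))

/-- `ρ*(a, b, c, d, a₁, b₁, …)` has `(x, y, z, w) = (a, b, c, d)`, `xⱼ = aⱼ` and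
`yⱼ = tⱼ(x, y, z, w, x₁, y₁, …, xⱼ₋₁, yⱼ₋₁)`. -/
def rhoStar (t : (i : Fin n) → L.Term (Var i)) (v : Var n → A) : Var n → A :=
  mkTuple (v .x) (v .y) (v .z) (v .w)
    (fun i => v (.xs i)) (recY t (v .x) (v .y) (v .z) (v .w) fun i => v (.xs i))

end Maps

/-! ### The identities -/

section Identities

/-- The term algebra over a set of variables. -/
instance termAlgebra (L : FirstOrder.Language.{u, v}) (α : Type*) : L.Structure (L.Term α) where
  funMap f ts := .func f ts
  RelMap _ _ := False

/-- The tuple of variables `X = (x, y, z, w, x₁, y₁, …, xₙ, yₙ)` in the term algebra `T(X)`. -/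
def vars (L : FirstOrder.Language.{u, v}) (n : ℕ) : Var n → L.Term (Var n) :=
  FirstOrder.Language.Term.var

/-- For a tuple `τ` of elements of `T(X)`, the identity `p(τ) ≈ q(τ)` holds in `V`. -/
def IdAt {L : FirstOrder.Language.{u, v}} (V : Variety L) {n : ℕ} (τ : Var n → L.Term (Var n))
    (p q : L.Term (Var n)) : Prop :=
  Variety.Models.{u, v, w} V (p.realize τ) (q.realize τ)

/-- `α` is a word in the alphabet `{1, …, N}`. -/
def IsWord (N : ℕ) (α : List ℕ) : Prop := ∀ j ∈ α, 1 ≤ j ∧ j ≤ N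

/-- The identities of the Mal'cev condition, for `N = 2k`, the terms `sᵢ`, `tᵢ` and the terms
`Lt α`, `Rt α` attached to the words `α` in the alphabet `{1, …, N}` of length at most `N` (the
values of `Lt` and `Rt` at other lists of numbers play no role). -/
structure MalcevIdentities {L : FirstOrder.Language.{u, v}} (V : Variety L) (k n : ℕ)
    (s t : (i : Fin n) → L.Term (Var i)) (Lt Rt : List ℕ → L.Term (Var n)) : Prop where
  -- words of length `N`
  full_rho : ∀ α, IsWord (2 * k) α → α.length = 2 * k →
    IdAt.{u, v, w} V (rho s (vars L n)) (Lt α) (Rt α)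
  full_rhoStar : ∀ α, IsWord (2 * k) α → α.length = 2 * k →
    IdAt.{u, v, w} V (rhoStar t (vars L n)) (Lt α) (Rt α)
  -- the empty word
  empty_left : Variety.Models.{u, v, w} V (vars L n .x) (Lt [])
  empty_right : Variety.Models.{u, v, w} V (vars L n .y) (Rt [])
  empty_rho_first : IdAt.{u, v, w} V (rho s (vars L n)) (Lt []) (Lt [1])
  empty_rho_step : ∀ j, 1 ≤ j → j + 1 ≤ 2 * k →
    IdAt.{u, v, w} V (rho s (vars L n)) (Rt [j]) (Lt [j + 1])
  empty_rho_last : IdAt.{u, v, w} V (rho s (vars L n)) (Rt [2 * k]) (Rt [])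
  -- words of even length strictly between `0` and `N`
  even_rho_first : ∀ α, IsWord (2 * k) α → 0 < α.length → α.length < 2 * k → Even α.length →
    IdAt.{u, v, w} V (rho s (vars L n)) (Lt α) (Lt (α ++ [1]))
  even_rho_step : ∀ α, IsWord (2 * k) α → 0 < α.length → α.length < 2 * k → Even α.length →
    ∀ j, 1 ≤ j → j + 1 ≤ k →
    IdAt.{u, v, w} V (rho s (vars L n)) (Rt (α ++ [j])) (Lt (α ++ [j + 1]))
  even_rho_last : ∀ α, IsWord (2 * k) α → 0 < α.length → α.length < 2 * k → Even α.length →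
    IdAt.{u, v, w} V (rho s (vars L n)) (Rt (α ++ [k])) (Rt α)
  even_rhoStar_first : ∀ α, IsWord (2 * k) α → 0 < α.length → α.length < 2 * k → Even α.length →
    IdAt.{u, v, w} V (rhoStar t (vars L n)) (Lt α) (Lt (α ++ [k + 1]))
  even_rhoStar_step : ∀ α, IsWord (2 * k) α → 0 < α.length → α.length < 2 * k → Even α.length →
    ∀ j, k + 1 ≤ j → j + 1 ≤ 2 * k →
    IdAt.{u, v, w} V (rhoStar t (vars L n)) (Rt (α ++ [j])) (Lt (α ++ [j + 1]))
  even_rhoStar_last : ∀ α, IsWord (2 * k) α → 0 < α.length → α.length < 2 * k → Even α.length →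
    IdAt.{u, v, w} V (rhoStar t (vars L n)) (Rt (α ++ [2 * k])) (Rt α)
  -- words of odd length strictly between `0` and `N`
  odd_sigma_first : ∀ α, IsWord (2 * k) α → 0 < α.length → α.length < 2 * k → Odd α.length →
    IdAt.{u, v, w} V (sigma s (vars L n)) (Lt α) (Lt (α ++ [1]))
  odd_sigma_step : ∀ α, IsWord (2 * k) α → 0 < α.length → α.length < 2 * k → Odd α.length →
    ∀ j, 1 ≤ j → j + 1 ≤ k →
    IdAt.{u, v, w} V (sigma s (vars L n)) (Rt (α ++ [j])) (Lt (α ++ [j + 1]))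
  odd_sigma_last : ∀ α, IsWord (2 * k) α → 0 < α.length → α.length < 2 * k → Odd α.length →
    IdAt.{u, v, w} V (sigma s (vars L n)) (Rt (α ++ [k])) (Rt α)
  odd_sigmaStar_first : ∀ α, IsWord (2 * k) α → 0 < α.length → α.length < 2 * k → Odd α.length →
    IdAt.{u, v, w} V (sigmaStar t (vars L n)) (Lt α) (Lt (α ++ [k + 1]))
  odd_sigmaStar_step : ∀ α, IsWord (2 * k) α → 0 < α.length → α.length < 2 * k → Odd α.length →
    ∀ j, k + 1 ≤ j → j + 1 ≤ 2 * k →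
    IdAt.{u, v, w} V (sigmaStar t (vars L n)) (Rt (α ++ [j])) (Lt (α ++ [j + 1]))
  odd_sigmaStar_last : ∀ α, IsWord (2 * k) α → 0 < α.length → α.length < 2 * k → Odd α.length →
    IdAt.{u, v, w} V (sigmaStar t (vars L n)) (Rt (α ++ [2 * k])) (Rt α)

end Identities

end BFC

/-!
A variety has Boolean factor congruences exactly when each of its algebras has the following
property (`FactorTransfer`): if `θ, θ'` and `φ, φ'` are complementary factor congruences, then
`x θ z φ w θ y` and `x θ' y` imply `x φ y`. For complementary `θ, θ'` let `mix a b` be the element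
that is `θ`-related to `a` and `θ'`-related to `b`. The property says that every factor congruence
is compatible with all these operations, and from this one computes that factor congruences
permute, that `θ ⊓ φ` and `θ' ⊔ φ'` are complementary, and that the distributive law holds
(`FactorTransfer.exists_sublattice`). Conversely, distributivity gives
`θ' ⊓ (φ ⊔ θ) = θ' ⊓ φ`, which is the property (`factorTransfer_of_sublattice`).

The identities are the syntactic form of this property.

*Identities imply the property* (`MalcevIdentities.factorTransfer`). Given `a, b, c, d` in the
roles of `x, y, z, w`, choose successively `aⱼ` with `aⱼ θ sⱼ`, `aⱼ θ' tⱼ` and `bⱼ` with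
`bⱼ φ sⱼ`, `bⱼ φ' tⱼ`. The resulting tuple is congruent to its images under `σ, σ*, ρ, ρ*` modulo
`θ, θ', φ, φ'`, so that the identities become chains of relations. By downward induction on the
length, `L_α` and `R_α` agree at the tuple for every nonempty word `α`; what is left for the empty
word is a chain of `φ`-steps from `a` to `b`.

*The property implies the identities* (`HasBFC.exists_malcevIdentities`). In the absolutely free
algebra of `WitnessTerm`s every pair `p, q` of elements has its own generators `xs p q`, `ys p q`.
Modulo the identities of the variety, the kernels `θ, θ', φ, φ'` of the substitutions
`σ, σ*, ρ, ρ*` therefore satisfy `θ ∘ θ' = φ ∘ φ' = 1`. To make them complementary one divides by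
the least congruence `δ` above `φ ⊓ φ'` with `δ = (θ ⊔ δ) ⊓ (θ' ⊔ δ) = (φ ⊔ δ) ⊓ (φ' ⊔ δ)`. It is
the union of the relations `Level`, obtained by alternating joins and meets with joins cut off at
a given chain length. The property in the quotient says that `(x, y)` is in `φ ⊔ δ`, so that `x`
and `y` are connected already at a finite stage (`exists_chain_of_hasBFC`). Unravelling this stage
gives a finite tree of pairs of witness terms (`Chain.exists_isTree`), whose nodes are the words
`α`. Finitely many witness terms involve finitely many generators, which can be listed so that
each of them depends on earlier ones only (`exists_system`); these are the variables `xⱼ, yⱼ`, and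
the pairs they belong to are the terms `sⱼ, tⱼ`.
-/

namespace BFC

/-! ### Factor congruences and decomposition operations -/

section Decomposition

variable {L : FirstOrder.Language.{u, v}} {A : Type*} [L.Structure A]

namespace Cong

theorem ext_r {θ φ : Cong L A} (h : ∀ a b, θ.r a b ↔ φ.r a b) : θ = φ :=
  le_antisymm (le_def.2 fun a b => (h a b).1) (le_def.2 fun a b => (h a b).2)

theorem refl (θ : Cong L A) (a : A) : θ.r a a := θ.iseqv.refl a

theorem symm (θ : Cong L A) {a b : A} (h : θ.r a b) : θ.r b a := θ.iseqv.symm h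

theorem trans (θ : Cong L A) {a b c : A} (h : θ.r a b) (h' : θ.r b c) : θ.r a c :=
  θ.iseqv.trans h h'

theorem bot_r {a b : A} : (⊥ : Cong L A).r a b ↔ a = b := Iff.rfl

theorem sup_r_left {θ φ : Cong L A} {a b : A} (h : θ.r a b) : (θ ⊔ φ).r a b :=
  le_def.1 le_sup_left a b h

theorem sup_r_right {θ φ : Cong L A} {a b : A} (h : φ.r a b) : (θ ⊔ φ).r a b :=
  le_def.1 le_sup_right a b h

/-- The join of two permuting congruences is their relational product. -/
theorem sup_r_of_permute {θ φ : Cong L A}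
    (h : ∀ a b c, θ.r a b → φ.r b c → ∃ d, φ.r a d ∧ θ.r d c) {a b : A} :
    (θ ⊔ φ).r a b ↔ ∃ c, θ.r a c ∧ φ.r c b := by
  constructor
  · let ψ : Cong L A :=
      { r := fun a b => ∃ c, θ.r a c ∧ φ.r c b
        iseqv := by
          refine ⟨fun a => ⟨a, θ.refl a, φ.refl a⟩, ?_, ?_⟩
          · rintro a b ⟨c, h1, h2⟩
            obtain ⟨d, h3, h4⟩ := h a c b h1 h2
            exact ⟨d, θ.symm h4, φ.symm h3⟩
          · rintro a b c ⟨d, h1, h2⟩ ⟨e, h3, h4⟩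
            obtain ⟨f, h5, h6⟩ := h e b d (θ.symm h3) (φ.symm h2)
            exact ⟨f, θ.trans h1 (θ.symm h6), φ.trans (φ.symm h5) h4⟩
        funMap_rel := by
          intro n f a b hab
          choose c h1 h2 using hab
          exact ⟨_, θ.funMap_rel n f _ _ h1, φ.funMap_rel n f _ _ h2⟩ }
    have : θ ⊔ φ ≤ ψ :=
      sup_le (le_def.2 fun a b hab => ⟨b, hab, φ.refl b⟩)
        (le_def.2 fun a b hab => ⟨a, θ.refl a, hab⟩)
    exact le_def.1 this a b
  · rintro ⟨c, h1, h2⟩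
    exact (θ ⊔ φ).trans (sup_r_left h1) (sup_r_right h2)

namespace Complementary

variable {θ θ' : Cong L A}

theorem eq (h : Complementary θ θ') {a b : A} (h1 : θ.r a b) (h2 : θ'.r a b) : a = b := by
  have : (θ ⊓ θ').r a b := ⟨h1, h2⟩
  rwa [h.1] at this

theorem symm (h : Complementary θ θ') : Complementary θ' θ := by
  refine ⟨inf_comm θ θ' ▸ h.1, fun a b => ?_⟩
  obtain ⟨c, h1, h2⟩ := h.2 b a
  exact ⟨c, θ'.symm h2, θ.symm h1⟩

/-- The decomposition operation of a pair of complementary factor congruences `θ, θ'`: the unique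
element that is `θ`-related to `a` and `θ'`-related to `b`. -/
noncomputable def mix (h : Complementary θ θ') (a b : A) : A := Classical.choose (h.2 a b)

theorem mix_left (h : Complementary θ θ') (a b : A) : θ.r (h.mix a b) a :=
  θ.symm (Classical.choose_spec (h.2 a b)).1

theorem mix_right (h : Complementary θ θ') (a b : A) : θ'.r (h.mix a b) b :=
  (Classical.choose_spec (h.2 a b)).2

theorem mix_eq (h : Complementary θ θ') {a b c : A} (h1 : θ.r c a) (h2 : θ'.r c b) :
    h.mix a b = c :=
  h.eq (θ.trans (h.mix_left a b) (θ.symm h1)) (θ'.trans (h.mix_right a b) (θ'.symm h2))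

end Complementary

end Cong

open Cong

variable (L A) in
/-- Every factor congruence `φ` of `A` is preserved by the maps `z ↦ mix z e`, where `mix` is the
decomposition operation of any complementary pair `θ, θ'`: here `x` and `y` are the values at `z`
and `w`. This is the form of Boolean factor congruences that the Mal'cev condition expresses. -/
def FactorTransfer : Prop :=
  ∀ θ θ' φ φ' : Cong L A, Complementary θ θ' → Complementary φ φ' →
    ∀ x y z w : A, θ.r x z → θ.r y w → θ'.r x y → φ.r z w → φ.r x y

namespace FactorTransfer

variable {θ θ' φ φ' ψ ψ' : Cong L A}

/-- A factor congruence is compatible with all decomposition operations. -/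
theorem mix_rel (H : FactorTransfer L A) (h : Complementary θ θ') (hφ : Complementary φ φ')
    {a b c d : A} (hac : φ.r a c) (hbd : φ.r b d) : φ.r (h.mix a b) (h.mix c d) := by
  have h1 : φ.r (h.mix a b) (h.mix c b) :=
    H θ θ' φ φ' h hφ _ _ a c (h.mix_left _ _) (h.mix_left _ _)
      (θ'.trans (h.mix_right _ _) (θ'.symm (h.mix_right _ _))) hac
  have h2 : φ.r (h.mix c b) (h.mix c d) :=
    H θ' θ φ φ' h.symm hφ _ _ b d (h.mix_right _ _) (h.mix_right _ _)
      (θ.trans (h.mix_left _ _) (θ.symm (h.mix_left _ _))) hbd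
  exact φ.trans h1 h2

theorem mix_self (h : Complementary θ θ') (a : A) : h.mix a a = a :=
  h.mix_eq (θ.refl a) (θ'.refl a)

/-- Factor congruences permute, so that their joins are relational products. -/
theorem sup_r (H : FactorTransfer L A) (h : Complementary θ θ') (hφ : Complementary φ φ')
    {a b : A} : (θ ⊔ φ).r a b ↔ ∃ c, θ.r a c ∧ φ.r c b := by
  refine sup_r_of_permute fun a b c hab hbc => ⟨h.mix c a, ?_, h.mix_left c a⟩
  have h1 := H.mix_rel h hφ hbc (φ.refl a)
  rw [h.mix_eq hab (θ'.refl a)] at h1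
  exact h1

theorem complementary_inf_sup (H : FactorTransfer L A) (h : Complementary θ θ')
    (hφ : Complementary φ φ') : Complementary (θ ⊓ φ) (θ' ⊔ φ') := by
  constructor
  · refine ext_r fun a b => ⟨fun hab => ?_, fun hab => ?_⟩
    · obtain ⟨⟨h1, h2⟩, h3⟩ := hab
      obtain ⟨c, h4, h5⟩ := (H.sup_r h.symm hφ.symm).1 h3
      -- Compute `mix a (mix a b)` (outer operation for `θ`, inner one for `φ`) in two ways.
      have e1 : hφ.mix a b = b := hφ.mix_eq (φ.symm h2) (φ'.refl b)
      have e2 : hφ.mix a b = hφ.mix a c :=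
        hφ.mix_eq (hφ.mix_left _ _) (φ'.trans (hφ.mix_right _ _) h5)
      have e3 : θ'.r a (hφ.mix a c) := by
        have := H.mix_rel hφ h.symm (θ'.refl a) h4
        rwa [mix_self] at this
      exact h.eq h1 (by rwa [← e2, e1] at e3)
    · cases bot_r.1 hab
      exact Cong.refl _ a
  · intro a b
    refine ⟨h.mix a (hφ.mix a b), ⟨θ.symm (h.mix_left _ _), ?_⟩, ?_⟩
    · have := H.mix_rel h hφ (φ.refl a) (hφ.mix_left a b)
      rw [mix_self] at this
      exact φ.symm this
    · exact (H.sup_r h.symm hφ.symm).2 ⟨_, h.mix_right _ _, hφ.mix_right _ _⟩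

theorem inf_sup_le (H : FactorTransfer L A) (h : Complementary θ θ') (hφ : Complementary φ φ')
    (hψ : Complementary ψ ψ') : θ ⊓ (φ ⊔ ψ) ≤ (θ ⊓ φ) ⊔ (θ ⊓ ψ) := by
  refine le_def.2 fun a b hab => ?_
  obtain ⟨h1, h2⟩ := hab
  obtain ⟨c, h3, h4⟩ := (H.sup_r hφ hψ).1 h2
  -- Replace the intermediate point by its projection to the `θ`-class of `a` and `b`.
  have e : h.mix a c = h.mix b c :=
    h.mix_eq (θ.trans (h.mix_left b c) (θ.symm h1)) (h.mix_right b c)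
  have h5 : φ.r a (h.mix a c) := by
    have := H.mix_rel h hφ (φ.refl a) h3
    rwa [mix_self] at this
  have h6 : ψ.r (h.mix a c) b := by
    have := H.mix_rel h hψ (ψ.refl b) h4
    rwa [mix_self, ← e] at this
  exact Cong.trans _ (sup_r_left ⟨θ.symm (h.mix_left a c), h5⟩)
    (sup_r_right ⟨θ.trans (h.mix_left a c) h1, h6⟩)

/-- If factor congruences are compatible with the decomposition operations, then they form a
distributive sublattice of the congruence lattice. -/
theorem exists_sublattice (H : FactorTransfer L A) :
    ∃ S : Sublattice (Cong L A), (S : Set (Cong L A)) = {θ | θ.IsFactor} ∧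
      ∀ θ ∈ S, ∀ φ ∈ S, ∀ ψ ∈ S, θ ⊓ (φ ⊔ ψ) = (θ ⊓ φ) ⊔ (θ ⊓ ψ) := by
  refine ⟨⟨{θ | θ.IsFactor}, ?_, ?_⟩, rfl, ?_⟩
  · rintro θ ⟨θ', h⟩ φ ⟨φ', hφ⟩
    exact ⟨θ' ⊓ φ', (H.complementary_inf_sup h.symm hφ.symm).symm⟩
  · rintro θ ⟨θ', h⟩ φ ⟨φ', hφ⟩
    exact ⟨θ' ⊔ φ', H.complementary_inf_sup h hφ⟩
  · rintro θ ⟨θ', h⟩ φ ⟨φ', hφ⟩ ψ ⟨ψ', hψ⟩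
    exact le_antisymm (H.inf_sup_le h hφ hψ)
      (sup_le (inf_le_inf_left _ le_sup_left) (inf_le_inf_left _ le_sup_right))

end FactorTransfer

/-- In a distributive sublattice of factor congruences `θ' ⊓ (φ ⊔ θ) = θ' ⊓ φ` for complementary
`θ, θ'`, and the hypotheses place `(x, y)` in `θ'` and in `φ ⊔ θ`. -/
theorem factorTransfer_of_sublattice (S : Sublattice (Cong L A))
    (hS : (S : Set (Cong L A)) = {θ | θ.IsFactor})
    (hd : ∀ θ ∈ S, ∀ φ ∈ S, ∀ ψ ∈ S, θ ⊓ (φ ⊔ ψ) = (θ ⊓ φ) ⊔ (θ ⊓ ψ)) : FactorTransfer L A := by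
  intro θ θ' φ φ' h hφ x y z w hxz hyw hxy hzw
  have hmem : ∀ {χ : Cong L A}, χ.IsFactor → χ ∈ S := fun {χ} hχ =>
    (Set.ext_iff.1 hS χ).2 hχ
  have m1 : θ ∈ S := hmem ⟨θ', h⟩
  have m2 : θ' ∈ S := hmem ⟨θ, h.symm⟩
  have m3 : φ ∈ S := hmem ⟨φ', hφ⟩
  have key : θ' ⊓ (φ ⊔ θ) = θ' ⊓ φ := by
    rw [hd _ m2 _ m3 _ m1, h.symm.1, sup_bot_eq]
  have h1 : (θ' ⊓ (φ ⊔ θ)).r x y :=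
    ⟨hxy, Cong.trans _ (sup_r_right hxz) (Cong.trans _ (sup_r_left hzw) (sup_r_right (θ.symm hyw)))⟩
  rw [key] at h1
  exact h1.2

end Decomposition

/-! ### Tolerances, chains and alternating joins -/

section Chains

variable {L : FirstOrder.Language.{u, v}} {A : Type*} [L.Structure A]

variable (L) in
/-- A tolerance: a reflexive, symmetric relation compatible with all operations. -/
structure IsTolerance (R : A → A → Prop) : Prop where
  refl : ∀ a, R a a
  symm : ∀ {a b}, R a b → R b a
  funMap_rel : ∀ (n : ℕ) (f : L.Functions n) (a b : Fin n → A), (∀ i, R (a i) (b i)) →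
    R (FirstOrder.Language.Structure.funMap f a) (FirstOrder.Language.Structure.funMap f b)

theorem Cong.isTolerance (θ : Cong L A) : IsTolerance L θ.r :=
  ⟨θ.refl, θ.symm, θ.funMap_rel⟩

theorem IsTolerance.and {R R' : A → A → Prop} (h : IsTolerance L R) (h' : IsTolerance L R') :
    IsTolerance L (fun a b => R a b ∧ R' a b) :=
  ⟨fun a => ⟨h.refl a, h'.refl a⟩, fun hab => ⟨h.symm hab.1, h'.symm hab.2⟩,
    fun n f a b hab => ⟨h.funMap_rel n f a b fun i => (hab i).1,
      h'.funMap_rel n f a b fun i => (hab i).2⟩⟩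

/-- The union of an increasing sequence of tolerances is a congruence as soon as it is
transitive. -/
def Cong.ofMonotone (W : ℕ → A → A → Prop) (hW : ∀ k, IsTolerance L (W k)) (hm : Monotone W)
    (ht : ∀ k a b c, W k a b → W k b c → ∃ k', W k' a c) : Cong L A where
  r a b := ∃ k, W k a b
  iseqv := by
    refine ⟨fun a => ⟨0, (hW 0).refl a⟩, fun ⟨k, h⟩ => ⟨k, (hW k).symm h⟩, ?_⟩
    rintro a b c ⟨k, h⟩ ⟨k', h'⟩
    exact ht (max k k') a b c (hm (le_max_left _ _) _ _ h) (hm (le_max_right _ _) _ _ h')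
  funMap_rel := by
    intro n f a b h
    choose k hk using h
    exact ⟨Finset.univ.sup k, (hW _).funMap_rel n f a b fun i =>
      hm (Finset.le_sup (Finset.mem_univ i)) _ _ (hk i)⟩

/-- `Chain S R k` is the relational product `S ∘ R ∘ S ∘ ⋯ ∘ R ∘ S` with `k` factors `R`. -/
def Chain (S R : A → A → Prop) : ℕ → A → A → Prop
  | 0 => S
  | k + 1 => fun a b => ∃ l r, S a l ∧ R l r ∧ Chain S R k r b

namespace Chain

variable {S R R' : A → A → Prop} {k k' : ℕ} {a b c d : A}

theorem mono_right (h : ∀ a b, R a b → R' a b) (hab : Chain S R k a b) : Chain S R' k a b := by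
  induction k generalizing a with
  | zero => exact hab
  | succ k ih =>
    obtain ⟨l, r, h1, h2, h3⟩ := hab
    exact ⟨l, r, h1, h _ _ h2, ih h3⟩

theorem mono_length (hS : ∀ a, S a a) (hR : ∀ a, R a a) (hk : k ≤ k') (h : Chain S R k a b) :
    Chain S R k' a b := by
  induction hk with
  | refl => exact h
  | step _ ih => exact ⟨a, a, hS a, hR a, ih⟩

theorem snoc (h : Chain S R k a b) (h1 : R b c) (h2 : S c d) : Chain S R (k + 1) a d := by
  induction k generalizing a with
  | zero => exact ⟨b, c, h, h1, h2⟩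
  | succ k ih =>
    obtain ⟨l, r, h3, h4, h5⟩ := h
    exact ⟨l, r, h3, h4, ih h5⟩

theorem symm (hS : ∀ {a b}, S a b → S b a) (hR : ∀ {a b}, R a b → R b a)
    (h : Chain S R k a b) : Chain S R k b a := by
  induction k generalizing a with
  | zero => exact hS h
  | succ k ih =>
    obtain ⟨l, r, h1, h2, h3⟩ := h
    exact (ih h3).snoc (hR h2) (hS h1)

theorem trans (hS : ∀ {a b c}, S a b → S b c → S a c) (h : Chain S R k a b)
    (h' : Chain S R k' b c) : Chain S R (k + k') a c := by
  induction k generalizing a with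
  | zero =>
    rw [Nat.zero_add]
    cases k' with
    | zero => exact hS h h'
    | succ k' =>
      obtain ⟨l, r, h1, h2, h3⟩ := h'
      exact ⟨l, r, hS h h1, h2, h3⟩
  | succ k ih =>
    obtain ⟨l, r, h1, h2, h3⟩ := h
    rw [Nat.succ_add]
    exact ⟨l, r, h1, h2, ih h3⟩

theorem isTolerance (hS : IsTolerance L S) (hR : IsTolerance L R) (k : ℕ) :
    IsTolerance L (Chain S R k) where
  refl a := mono_length (k := 0) hS.refl hR.refl (Nat.zero_le k) (hS.refl a)
  symm := symm hS.symm hR.symm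
  funMap_rel n f := by
    induction k with
    | zero => exact hS.funMap_rel n f
    | succ k ih =>
      intro a b h
      choose l r h1 h2 h3 using h
      exact ⟨_, _, hS.funMap_rel n f _ _ h1, hR.funMap_rel n f _ _ h2, ih _ _ h3⟩

/-- The intermediate points of a chain, numbered from `1`. -/
theorem exists_points (hab : Chain S R (k + 1) a b) :
    ∃ l r : ℕ → A, S a (l 1) ∧ (∀ j, 1 ≤ j → j ≤ k + 1 → R (l j) (r j)) ∧
      (∀ j, 1 ≤ j → j + 1 ≤ k + 1 → S (r j) (l (j + 1))) ∧ S (r (k + 1)) b := by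
  induction k generalizing a with
  | zero =>
    obtain ⟨l, r, h1, h2, h3⟩ := hab
    refine ⟨fun _ => l, fun _ => r, h1, fun _ _ _ => h2, fun j h h' => ?_, h3⟩
    omega
  | succ k ih =>
    obtain ⟨l, r, h1, h2, h3⟩ := hab
    obtain ⟨l', r', h4, h5, h6, h7⟩ := ih h3
    refine ⟨fun j => if j = 1 then l else l' (j - 1), fun j => if j = 1 then r else r' (j - 1),
      by simpa using h1, fun j hj hj' => ?_, fun j hj hj' => ?_, by simpa using h7⟩
    · obtain rfl | ⟨i, rfl⟩ : j = 1 ∨ ∃ i, j = i + 2 := by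
        rcases j with _ | _ | i
        · omega
        · exact Or.inl rfl
        · exact Or.inr ⟨i, rfl⟩
      · simpa using h2
      · simpa using h5 (i + 1) (by omega) (by omega)
    · obtain rfl | ⟨i, rfl⟩ : j = 1 ∨ ∃ i, j = i + 2 := by
        rcases j with _ | _ | i
        · omega
        · exact Or.inl rfl
        · exact Or.inr ⟨i, rfl⟩
      · simpa using h4
      · simpa using h6 (i + 1) (by omega) (by omega)

end Chain

/-- The alternating sequence `φ, θ, φ, θ, …`. -/
def alternate (φ θ : Cong L A) (m : ℕ) : Cong L A := if Even m then φ else θ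

theorem alternate_even (φ θ : Cong L A) {m : ℕ} (h : Even m) : alternate φ θ m = φ := if_pos h

theorem alternate_odd (φ θ : Cong L A) {m : ℕ} (h : Odd m) : alternate φ θ m = θ :=
  if_neg (Nat.not_even_iff_odd.2 h)

/-- Starting from the meet of two congruences, `Level S T k` repeatedly forms the meet of the
joins with the next two congruences `S m`, `T m`, where joins are replaced by chains with `k`
links. -/
def Level (S T : ℕ → Cong L A) (k : ℕ) : ℕ → A → A → Prop
  | 0 => fun a b => (S 0).r a b ∧ (T 0).r a b
  | m + 1 => fun a b => Chain (S (m + 1)).r (Level S T k m) k a b ∧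
      Chain (T (m + 1)).r (Level S T k m) k a b

namespace Level

variable {S T : ℕ → Cong L A} {k k' m m' : ℕ} {a b : A}

theorem isTolerance (S T : ℕ → Cong L A) (k m : ℕ) : IsTolerance L (Level S T k m) := by
  induction m with
  | zero => exact (S 0).isTolerance.and (T 0).isTolerance
  | succ m ih =>
    exact (Chain.isTolerance (S _).isTolerance ih k).and
      (Chain.isTolerance (T _).isTolerance ih k)

theorem mono_width (hk : k ≤ k') (h : Level S T k m a b) : Level S T k' m a b := by
  induction m generalizing a b with
  | zero => exact h
  | succ m ih =>
    exact ⟨(h.1.mono_right fun _ _ => ih).mono_length (S _).refl (isTolerance S T k' m).refl hk,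
      (h.2.mono_right fun _ _ => ih).mono_length (T _).refl (isTolerance S T k' m).refl hk⟩

theorem succ_depth (h : Level S T (k + 1) m a b) : Level S T (k + 1) (m + 1) a b := by
  constructor
  · exact Chain.mono_length (k := 1) (S _).refl (isTolerance S T _ m).refl (by omega)
      ⟨a, b, (S _).refl a, h, (S _).refl b⟩
  · exact Chain.mono_length (k := 1) (T _).refl (isTolerance S T _ m).refl (by omega)
      ⟨a, b, (T _).refl a, h, (T _).refl b⟩

theorem mono_depth (hm : m ≤ m') (h : Level S T (k + 1) m a b) : Level S T (k + 1) m' a b := by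
  induction hm with
  | refl => exact h
  | step _ ih => exact ih.succ_depth

theorem monotone (S T : ℕ → Cong L A) : Monotone fun k => Level S T (k + 1) (2 * k + 1) :=
  monotone_nat_of_le_succ fun _ _ _ h =>
    (mono_width (Nat.le_succ _) h).succ_depth.succ_depth

/-- The limit of the relations `Level S T`. It contains `S 0 ⊓ T 0`, and it is the meet of its
joins with `S m` and `T m` whenever `S` and `T` are periodic with period `2`. -/
def limit (S T : ℕ → Cong L A) : Cong L A :=
  Cong.ofMonotone (fun k => Level S T (k + 1) (2 * k + 1)) (fun _ => isTolerance S T _ _)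
    (monotone S T) (by
      intro k a b c h1 h2
      have h1' := mono_width (k' := k + 2) (by omega) h1
      have h2' := mono_width (k' := k + 2) (by omega) h2
      refine ⟨k + 1, succ_depth ⟨?_, ?_⟩⟩
      · exact Chain.mono_length (k := 2) (S _).refl (isTolerance S T _ _).refl (by omega)
          ⟨a, b, (S _).refl a, h1', b, c, (S _).refl b, h2', (S _).refl c⟩
      · exact Chain.mono_length (k := 2) (T _).refl (isTolerance S T _ _).refl (by omega)
          ⟨a, b, (T _).refl a, h1', b, c, (T _).refl b, h2', (T _).refl c⟩)

/-- The join of a congruence with `Level.limit S T`, as a union of chains. -/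
def joinLimit (S T : ℕ → Cong L A) (ψ : Cong L A) : Cong L A :=
  Cong.ofMonotone (fun k => Chain ψ.r (Level S T (k + 1) (2 * k + 1)) (k + 1))
    (fun _ => Chain.isTolerance ψ.isTolerance (isTolerance S T _ _) _)
    (fun _ _ hk _ _ h => (h.mono_right (monotone S T hk)).mono_length ψ.refl
      (isTolerance S T _ _).refl (by omega)) (by
      intro k a b c h1 h2
      have hk : k ≤ 2 * k + 1 := by omega
      refine ⟨2 * k + 1, ?_⟩
      exact Chain.mono_length (k := k + 1 + (k + 1)) ψ.refl (isTolerance S T _ _).refl (by omega)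
        ((Chain.trans (S := ψ.r) ψ.trans h1 h2).mono_right (monotone S T hk)))

theorem limit_le_joinLimit (ψ : Cong L A) : limit S T ≤ joinLimit S T ψ := by
  refine Cong.le_def.2 ?_
  rintro a b ⟨k, h⟩
  exact ⟨k, Chain.mono_length (k := 1) ψ.refl (isTolerance S T _ _).refl (by omega)
    ⟨a, b, ψ.refl a, h, ψ.refl b⟩⟩

theorem le_joinLimit (ψ : Cong L A) : ψ ≤ joinLimit S T ψ :=
  Cong.le_def.2 fun _ _ h => ⟨0, Chain.mono_length (k := 0) ψ.refl (isTolerance S T _ _).refl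
    (by omega) h⟩

theorem inf_le_limit : S 0 ⊓ T 0 ≤ limit S T :=
  Cong.le_def.2 fun _ _ h => ⟨0, succ_depth (m := 0) h⟩

theorem joinLimit_inf_joinLimit_le (hS : ∀ m, S (m + 2) = S m) (hT : ∀ m, T (m + 2) = T m)
    (m : ℕ) : joinLimit S T (S m) ⊓ joinLimit S T (T m) ≤ limit S T := by
  have hS' : ∀ i, S (m + 2 * i) = S m := fun i => by
    induction i with
    | zero => rfl
    | succ i ih => rw [← ih, ← hS (m + 2 * i)]; rfl
  have hT' : ∀ i, T (m + 2 * i) = T m := fun i => by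
    induction i with
    | zero => rfl
    | succ i ih => rw [← ih, ← hT (m + 2 * i)]; rfl
  refine Cong.le_def.2 ?_
  rintro a b ⟨⟨k, h⟩, ⟨k', h'⟩⟩
  set K := max k k' with hK
  have hk : k ≤ K := le_max_left _ _
  have hk' : k' ≤ K := le_max_right _ _
  have up : ∀ i ≤ K, ∀ a b, Level S T (i + 1) (2 * i + 1) a b →
      Level S T (K + 1) (m + 2 * K + 1) a b := fun i hi a b hab =>
    mono_depth (by omega) (monotone S T hi a b hab)
  have hlast : Level S T (K + 1) (m + 2 * K + 1 + 1) a b := by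
    constructor
    · rw [show m + 2 * K + 1 + 1 = m + 2 * (K + 1) by omega, hS']
      exact (h.mono_right (up k hk)).mono_length (S _).refl (isTolerance S T _ _).refl (by omega)
    · rw [show m + 2 * K + 1 + 1 = m + 2 * (K + 1) by omega, hT']
      exact (h'.mono_right (up k' hk')).mono_length (T _).refl (isTolerance S T _ _).refl
        (by omega)
  exact ⟨K + m + 1, mono_width (k := K + 1) (by omega) (mono_depth (by omega) hlast)⟩

end Level

end Chains

/-! ### Quotient algebras -/

section Quotient

variable {L : FirstOrder.Language.{u, v}} {A : Type*} [L.Structure A]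

namespace Cong

open FirstOrder.Language.Structure

/-- The quotient algebra. All relation symbols are interpreted by the empty relation. -/
noncomputable instance quotientStructure (δ : Cong L A) : L.Structure (Quotient δ.toSetoid) where
  funMap f a := Quotient.mk δ.toSetoid (funMap f fun i => (a i).out)
  RelMap _ _ := False

theorem funMap_mk (δ : Cong L A) {n : ℕ} (f : L.Functions n) (a : Fin n → A) :
    funMap f (fun i => Quotient.mk δ.toSetoid (a i)) = Quotient.mk δ.toSetoid (funMap f a) :=
  Quotient.sound (s := δ.toSetoid) (δ.funMap_rel n f _ _ fun i =>
    Quotient.exact (s := δ.toSetoid) (Quotient.out_eq (Quotient.mk δ.toSetoid (a i))))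

theorem realize_mk (δ : Cong L A) {α : Type*} (p : L.Term α) (e : α → A) :
    p.realize (fun i => Quotient.mk δ.toSetoid (e i)) = Quotient.mk δ.toSetoid (p.realize e) := by
  induction p with
  | var i => rfl
  | func f ts ih =>
    simp only [FirstOrder.Language.Term.realize_func, ih]
    exact δ.funMap_mk f _

/-- The congruence induced on the quotient by `δ` by a congruence above `δ`. -/
def quot (δ θ : Cong L A) (h : δ ≤ θ) : Cong L (Quotient δ.toSetoid) where
  r a b := θ.r a.out b.out
  iseqv := ⟨fun a => θ.refl _, fun h => θ.symm h, fun h h' => θ.trans h h'⟩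
  funMap_rel n f a b hab := by
    have key : ∀ c : Fin n → Quotient δ.toSetoid,
        θ.r (funMap f c).out (funMap f fun i => (c i).out) := fun c =>
      le_def.1 h _ _ (Quotient.exact (s := δ.toSetoid) (Quotient.out_eq _))
    exact θ.trans (key a) (θ.trans (θ.funMap_rel n f _ _ hab) (θ.symm (key b)))

theorem quot_mk {δ θ : Cong L A} (h : δ ≤ θ) {a b : A} :
    (quot δ θ h).r (Quotient.mk δ.toSetoid a) (Quotient.mk δ.toSetoid b) ↔ θ.r a b := by
  have key : ∀ c : A, θ.r (Quotient.mk δ.toSetoid c).out c := fun c =>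
    le_def.1 h _ _ (Quotient.exact (s := δ.toSetoid) (Quotient.out_eq _))
  exact ⟨fun hab => θ.trans (θ.symm (key a)) (θ.trans hab (key b)),
    fun hab => θ.trans (key a) (θ.trans hab (θ.symm (key b)))⟩

theorem complementary_quot {δ θ θ' : Cong L A} (h : δ ≤ θ) (h' : δ ≤ θ') (hinf : θ ⊓ θ' ≤ δ)
    (hprod : ∀ a b, ∃ c, θ.r a c ∧ θ'.r c b) : Complementary (quot δ θ h) (quot δ θ' h') := by
  constructor
  · refine ext_r fun a b => ⟨fun hab => ?_, fun hab => ?_⟩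
    · induction a using Quotient.inductionOn
      induction b using Quotient.inductionOn
      exact Quotient.sound (s := δ.toSetoid) (le_def.1 hinf _ _
        ⟨(quot_mk h).1 hab.1, (quot_mk h').1 hab.2⟩)
    · cases bot_r.1 hab
      exact Cong.refl _ a
  · intro a b
    induction a using Quotient.inductionOn with | h a => ?_
    induction b using Quotient.inductionOn with | h b => ?_
    obtain ⟨c, h1, h2⟩ := hprod a b
    exact ⟨Quotient.mk _ c, (quot_mk h).2 h1, (quot_mk h').2 h2⟩

/-- A quotient of `A` satisfies all identities that hold in `A` up to the congruence. -/
theorem mem_quotient [Nonempty A] (V : Variety L) (δ : Cong L A)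
    (h : ∀ p ∈ V.identities, ∀ e : ℕ → A, δ.r (p.1.realize e) (p.2.realize e)) :
    V.Mem (Quotient δ.toSetoid) := by
  refine ⟨⟨Quotient.mk _ (Classical.arbitrary A)⟩, fun p hp e => ?_⟩
  have he : e = fun i => Quotient.mk δ.toSetoid (e i).out :=
    funext fun i => (Quotient.out_eq _).symm
  rw [he, realize_mk, realize_mk]
  exact Quotient.sound (s := δ.toSetoid) (h p hp _)

end Cong

/-- If all quotients of `A` in `V` have Boolean factor congruences, then already a finite stage of
the construction of the limit relates `x` and `y`. -/
theorem exists_chain_of_hasBFC {V : Variety L} (hV : HasBFC.{u, v, w} V) {A : Type (max u w)}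
    [L.Structure A] [Nonempty A] (θ θ' φ φ' : Cong L A)
    (hid : ∀ p ∈ V.identities, ∀ e : ℕ → A, (φ ⊓ φ').r (p.1.realize e) (p.2.realize e))
    (hθ : ∀ a b, ∃ c, θ.r a c ∧ θ'.r c b) (hφ : ∀ a b, ∃ c, φ.r a c ∧ φ'.r c b)
    {x y z w : A} (hxz : θ.r x z) (hyw : θ.r y w) (hxy : θ'.r x y) (hzw : φ.r z w) :
    ∃ k, Chain φ.r (Level (alternate φ θ) (alternate φ' θ') (k + 1) (2 * k + 1)) (2 * k + 2)
      x y := by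
  set S := alternate φ θ with hS
  set T := alternate φ' θ' with hT
  have hS2 : ∀ m, S (m + 2) = S m := fun m => by simp [hS, alternate, Nat.even_add]
  have hT2 : ∀ m, T (m + 2) = T m := fun m => by simp [hT, alternate, Nat.even_add]
  set δ := Level.limit S T with hδ
  have hcomp : ∀ m, (∀ a b, ∃ c, (S m).r a c ∧ (T m).r c b) →
      Cong.Complementary (Cong.quot δ _ (Level.limit_le_joinLimit (S := S) (T := T) (S m)))
        (Cong.quot δ _ (Level.limit_le_joinLimit (S := S) (T := T) (T m))) := fun m h =>
    Cong.complementary_quot _ _ (Level.joinLimit_inf_joinLimit_le hS2 hT2 m) fun a b => by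
      obtain ⟨c, h1, h2⟩ := h a b
      exact ⟨c, Cong.le_def.1 (Level.le_joinLimit _) _ _ h1,
        Cong.le_def.1 (Level.le_joinLimit _) _ _ h2⟩
  have hmem : V.Mem (Quotient δ.toSetoid) := Cong.mem_quotient V δ fun p hp e =>
    Cong.le_def.1 (Level.inf_le_limit (S := S) (T := T)) _ _ (hid p hp e)
  obtain ⟨F, hF, hd⟩ := hV (Quotient δ.toSetoid) hmem
  have H := factorTransfer_of_sublattice F hF hd _ _ _ _ (hcomp 1 hθ) (hcomp 0 hφ)
    (Quotient.mk _ x) (Quotient.mk _ y) (Quotient.mk _ z) (Quotient.mk _ w)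
    ((Cong.quot_mk _).2 (Cong.le_def.1 (Level.le_joinLimit _) _ _ hxz))
    ((Cong.quot_mk _).2 (Cong.le_def.1 (Level.le_joinLimit _) _ _ hyw))
    ((Cong.quot_mk _).2 (Cong.le_def.1 (Level.le_joinLimit _) _ _ hxy))
    ((Cong.quot_mk _).2 (Cong.le_def.1 (Level.le_joinLimit _) _ _ hzw))
  obtain ⟨k, hk⟩ := (Cong.quot_mk _).1 H
  exact ⟨k, hk.mono_length φ.refl (Level.isTolerance S T _ _).refl (by omega)⟩

end Quotient

/-! ### Evaluating the maps `σ`, `σ*`, `ρ`, `ρ*` -/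

section Evaluation

open FirstOrder.Language (HomClass)

open scoped FirstOrder

variable {L : FirstOrder.Language.{u, v}} {A B : Type*} [L.Structure A] [L.Structure B] {n : ℕ}

theorem comp_mkTuple {A B : Type*} (f : A → B) (a b c d : A) (p q : Fin n → A) :
    (fun i => f (mkTuple a b c d p q i)) =
      mkTuple (f a) (f b) (f c) (f d) (fun i => f (p i)) (fun i => f (q i)) := by
  funext i
  cases i <;> rfl

theorem map_recX (f : A →[L] B) (s : (i : Fin n) → L.Term (Var i)) (x y z w : A) (q : Fin n → A)
    (j : Fin n) : f (recX s x y z w q j) = recX s (f x) (f y) (f z) (f w) (fun i => f (q i)) j := by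
  induction j using WellFoundedLT.induction with
  | ind j ih =>
    rw [recX, recX, ← HomClass.realize_term, Function.comp_def, comp_mkTuple]
    congr 2
    exact funext fun i => ih _ i.isLt

theorem map_recY (f : A →[L] B) (s : (i : Fin n) → L.Term (Var i)) (x y z w : A) (p : Fin n → A)
    (j : Fin n) : f (recY s x y z w p j) = recY s (f x) (f y) (f z) (f w) (fun i => f (p i)) j := by
  induction j using WellFoundedLT.induction with
  | ind j ih =>
    rw [recY, recY, ← HomClass.realize_term, Function.comp_def, comp_mkTuple]
    congr 2
    exact funext fun i => ih _ i.isLt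

/-- Evaluation of terms, as a homomorphism on the term algebra. -/
def realizeHom {α : Type*} (e : α → A) : L.Term α →[L] A where
  toFun p := p.realize e
  map_fun' _ _ := rfl
  map_rel' _ _ h := h.elim

variable {V : Variety L} {p q : L.Term (Var n)}

/-- An identity at a tuple `τ X` can be tested at the tuples `τ e`, whenever the operation `τ` on
tuples commutes with evaluation. -/
theorem idAt_iff {τ : ∀ {C : Type (max u w)} [L.Structure C], (Var n → C) → Var n → C}
    {τ₀ : Var n → L.Term (Var n)}
    (hτ : ∀ (C : Type (max u w)) [L.Structure C] (e : Var n → C) i,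
      (τ₀ i).realize e = τ e i) :
    IdAt.{u, v, w} V τ₀ p q ↔ ∀ (C : Type (max u w)) [L.Structure C], V.Mem C →
      ∀ e : Var n → C, p.realize (τ e) = q.realize (τ e) := by
  have key : ∀ (r : L.Term (Var n)) (C : Type (max u w)) [L.Structure C] (e : Var n → C),
      (r.realize τ₀).realize e = r.realize (τ e) := fun r C _ e => by
    have := (HomClass.realize_term (realizeHom (L := L) e) (t := r) (v := τ₀)).symm
    refine this.trans (congrArg r.realize (funext fun i => hτ C e i))
  refine forall_congr' fun C => forall_congr' fun _ => forall_congr' fun _ =>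
    forall_congr' fun e => ?_
  rw [key, key]

theorem idAt_sigma_iff {s : (i : Fin n) → L.Term (Var i)} :
    IdAt.{u, v, w} V (sigma s (vars L n)) p q ↔ ∀ (C : Type (max u w)) [L.Structure C], V.Mem C →
      ∀ e : Var n → C, p.realize (sigma s e) = q.realize (sigma s e) :=
  idAt_iff (τ := fun e => sigma s e) fun C _ e i => by
    cases i
    case xs j => exact map_recX (realizeHom e) s _ _ _ _ _ j
    all_goals rfl

theorem idAt_sigmaStar_iff {s : (i : Fin n) → L.Term (Var i)} :
    IdAt.{u, v, w} V (sigmaStar s (vars L n)) p q ↔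
      ∀ (C : Type (max u w)) [L.Structure C], V.Mem C →
        ∀ e : Var n → C, p.realize (sigmaStar s e) = q.realize (sigmaStar s e) :=
  idAt_iff (τ := fun e => sigmaStar s e) fun C _ e i => by
    cases i
    case xs j => exact map_recX (realizeHom e) s _ _ _ _ _ j
    all_goals rfl

theorem idAt_rho_iff {s : (i : Fin n) → L.Term (Var i)} :
    IdAt.{u, v, w} V (rho s (vars L n)) p q ↔ ∀ (C : Type (max u w)) [L.Structure C], V.Mem C →
      ∀ e : Var n → C, p.realize (rho s e) = q.realize (rho s e) :=
  idAt_iff (τ := fun e => rho s e) fun C _ e i => by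
    cases i
    case ys j => exact map_recY (realizeHom e) s _ _ _ _ _ j
    all_goals rfl

theorem idAt_rhoStar_iff {s : (i : Fin n) → L.Term (Var i)} :
    IdAt.{u, v, w} V (rhoStar s (vars L n)) p q ↔
      ∀ (C : Type (max u w)) [L.Structure C], V.Mem C →
        ∀ e : Var n → C, p.realize (rhoStar s e) = q.realize (rhoStar s e) :=
  idAt_iff (τ := fun e => rhoStar s e) fun C _ e i => by
    cases i
    case ys j => exact map_recY (realizeHom e) s _ _ _ _ _ j
    all_goals rfl

end Evaluation

/-! ### From the identities to Boolean factor congruences -/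

section Sufficiency

variable {L : FirstOrder.Language.{u, v}} {A : Type*} [L.Structure A] {n : ℕ}

theorem Cong.realize_rel (θ : Cong L A) {α : Type*} {e e' : α → A} (h : ∀ i, θ.r (e i) (e' i))
    (p : L.Term α) : θ.r (p.realize e) (p.realize e') := by
  induction p with
  | var i => exact h i
  | func f ts ih => exact θ.funMap_rel _ f _ _ ih

/-- The value of the term `s` at `(a, b, c, d, p₀, q₀, …, pⱼ₋₁, qⱼ₋₁)`. -/
def valueAt (a b c d : A) (p q : ℕ → A) {j : ℕ} (s : L.Term (Var j)) : A :=
  s.realize (mkTuple a b c d (fun i => p i) (fun i => q i))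

/-- Elements `pⱼ`, `qⱼ` witnessing, one after the other, that the relational products of two pairs
of congruences are universal. -/
theorem exists_witnesses {θ θ' φ φ' : Cong L A} (hθ : ∀ a b, ∃ c, θ.r a c ∧ θ'.r c b)
    (hφ : ∀ a b, ∃ c, φ.r a c ∧ φ'.r c b) (s t : (i : Fin n) → L.Term (Var i)) (a b c d : A) :
    ∃ p q : ℕ → A, ∀ j : Fin n,
      θ.r (p j) (valueAt a b c d p q (s j)) ∧ θ'.r (p j) (valueAt a b c d p q (t j)) ∧
      φ.r (q j) (valueAt a b c d p q (s j)) ∧ φ'.r (q j) (valueAt a b c d p q (t j)) := by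
  suffices H : ∀ m ≤ n, ∃ p q : ℕ → A, ∀ j : Fin n, j < m →
      θ.r (p j) (valueAt a b c d p q (s j)) ∧ θ'.r (p j) (valueAt a b c d p q (t j)) ∧
      φ.r (q j) (valueAt a b c d p q (s j)) ∧ φ'.r (q j) (valueAt a b c d p q (t j)) by
    obtain ⟨p, q, h⟩ := H n le_rfl
    exact ⟨p, q, fun j => h j j.isLt⟩
  intro m
  induction m with
  | zero => exact fun _ => ⟨fun _ => a, fun _ => a, fun j hj => absurd hj (Nat.not_lt_zero _)⟩
  | succ m ih =>
    intro hm
    obtain ⟨p, q, h⟩ := ih (by omega)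
    obtain ⟨p', hp, hp'⟩ := hθ (valueAt a b c d p q (s ⟨m, hm⟩)) (valueAt a b c d p q (t ⟨m, hm⟩))
    obtain ⟨q', hq, hq'⟩ := hφ (valueAt a b c d p q (s ⟨m, hm⟩)) (valueAt a b c d p q (t ⟨m, hm⟩))
    have key : ∀ {j : ℕ} (_ : j ≤ m) (r : L.Term (Var j)),
        valueAt a b c d (Function.update p m p') (Function.update q m q') r =
          valueAt a b c d p q r := by
      intro j hj r
      have hne : ∀ i : Fin j, (i : ℕ) ≠ m := fun i => by omega
      simp [valueAt, Function.update_of_ne (hne _)]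
    refine ⟨Function.update p m p', Function.update q m q', fun j hj => ?_⟩
    rw [key (by omega), key (by omega)]
    rcases Nat.lt_succ_iff_lt_or_eq.1 hj with hlt | heq
    · rw [Function.update_of_ne hlt.ne, Function.update_of_ne hlt.ne]
      exact h j hlt
    · obtain rfl : j = ⟨m, hm⟩ := Fin.ext heq
      simp only [Function.update_self]
      exact ⟨θ.symm hp, hp', φ.symm hq, hq'⟩

theorem recX_rel {θ : Cong L A} {s : (i : Fin n) → L.Term (Var i)} {a b c d a' b' c' d' : A}
    (ha : θ.r a a') (hb : θ.r b b') (hc : θ.r c c') (hd : θ.r d d') {p q : ℕ → A}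
    (h : ∀ j : Fin n, θ.r (p j) (valueAt a b c d p q (s j))) (j : Fin n) :
    θ.r (p j) (recX s a' b' c' d' (fun i => q i) j) := by
  induction j using WellFoundedLT.induction with
  | ind j ih =>
    rw [recX]
    refine θ.trans (h j) (θ.realize_rel (fun i => ?_) _)
    cases i with
    | x => exact ha
    | y => exact hb
    | z => exact hc
    | w => exact hd
    | xs i => exact ih (i.castLE j.isLt.le) i.isLt
    | ys i => exact θ.refl _

theorem recY_rel {θ : Cong L A} {s : (i : Fin n) → L.Term (Var i)} {a b c d a' b' c' d' : A}
    (ha : θ.r a a') (hb : θ.r b b') (hc : θ.r c c') (hd : θ.r d d') {p q : ℕ → A}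
    (h : ∀ j : Fin n, θ.r (q j) (valueAt a b c d p q (s j))) (j : Fin n) :
    θ.r (q j) (recY s a' b' c' d' (fun i => p i) j) := by
  induction j using WellFoundedLT.induction with
  | ind j ih =>
    rw [recY]
    refine θ.trans (h j) (θ.realize_rel (fun i => ?_) _)
    cases i with
    | x => exact ha
    | y => exact hb
    | z => exact hc
    | w => exact hd
    | xs i => exact θ.refl _
    | ys i => exact ih (i.castLE j.isLt.le) i.isLt

theorem Cong.rel_of_links (θ : Cong L A) {l r : ℕ → A} {a b : A} {i m : ℕ} (him : i ≤ m)
    (h0 : θ.r a (l i)) (hlr : ∀ j, i ≤ j → j ≤ m → l j = r j)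
    (hs : ∀ j, i ≤ j → j + 1 ≤ m → θ.r (r j) (l (j + 1))) (h1 : θ.r (r m) b) : θ.r a b := by
  suffices H : ∀ m', i ≤ m' → m' ≤ m → θ.r a (r m') from θ.trans (H m him le_rfl) h1
  intro m' hm'
  induction m', hm' using Nat.le_induction with
  | base => exact fun h => hlr i le_rfl h ▸ h0
  | succ j hj ih =>
    intro h
    rw [← hlr (j + 1) (by omega) h]
    exact θ.trans (ih (by omega)) (hs j hj h)

/-- The identities imply that factor congruences are compatible with decomposition operations. At
a tuple of witnesses, an identity at `σ`, `σ*`, `ρ`, `ρ*` becomes a relation modulo `θ`, `θ'`, `φ`,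
`φ'`; since `θ`, `θ'` and `φ`, `φ'` are disjoint, downward induction on the length of `α` makes the
values of the terms attached to each nonempty word `α` equal. -/
theorem MalcevIdentities.factorTransfer {V : Variety L} {k : ℕ}
    {s t : (i : Fin n) → L.Term (Var i)} {Lt Rt : List ℕ → L.Term (Var n)} (hk : 1 ≤ k)
    (M : MalcevIdentities.{u, v, w} V k n s t Lt Rt) {A : Type (max u w)} [L.Structure A]
    (hA : V.Mem A) : FactorTransfer L A := by
  intro θ θ' φ φ' hθ hφ a b c d hac hbd hab hcd
  obtain ⟨p, q, h⟩ := exists_witnesses hθ.2 hφ.2 s t a b c d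
  set e : Var n → A := mkTuple a b c d (fun i => p i) (fun i => q i) with he
  have hσ : ∀ P Q, IdAt.{u, v, w} V (sigma s (vars L n)) P Q →
      θ.r (P.realize e) (Q.realize e) := fun P Q hPQ => by
    have hs : ∀ i, θ.r (e i) (sigma s e i) := by
      intro i
      cases i with
      | x => exact θ.refl _
      | y => exact θ.refl _
      | z => exact θ.symm hac
      | w => exact θ.symm hbd
      | xs j => exact recX_rel (θ.refl _) (θ.refl _) (θ.symm hac) (θ.symm hbd) (fun j => (h j).1) j
      | ys j => exact θ.refl _
    have h1 := θ.realize_rel hs P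
    rw [idAt_sigma_iff.1 hPQ A hA e] at h1
    exact θ.trans h1 (θ.symm (θ.realize_rel hs Q))
  have hσ' : ∀ P Q, IdAt.{u, v, w} V (sigmaStar t (vars L n)) P Q →
      θ'.r (P.realize e) (Q.realize e) := fun P Q hPQ => by
    have hs : ∀ i, θ'.r (e i) (sigmaStar t e i) := by
      intro i
      cases i with
      | x => exact θ'.refl _
      | y => exact θ'.symm hab
      | z => exact θ'.refl _
      | w => exact θ'.refl _
      | xs j =>
        exact recX_rel (θ'.refl _) (θ'.symm hab) (θ'.refl _) (θ'.refl _) (fun j => (h j).2.1) j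
      | ys j => exact θ'.refl _
    have h1 := θ'.realize_rel hs P
    rw [idAt_sigmaStar_iff.1 hPQ A hA e] at h1
    exact θ'.trans h1 (θ'.symm (θ'.realize_rel hs Q))
  have hρ : ∀ P Q, IdAt.{u, v, w} V (rho s (vars L n)) P Q →
      φ.r (P.realize e) (Q.realize e) := fun P Q hPQ => by
    have hs : ∀ i, φ.r (e i) (rho s e i) := by
      intro i
      cases i with
      | x => exact φ.refl _
      | y => exact φ.refl _
      | z => exact φ.refl _
      | w => exact φ.symm hcd
      | xs j => exact φ.refl _
      | ys j =>
        exact recY_rel (φ.refl _) (φ.refl _) (φ.refl _) (φ.symm hcd) (fun j => (h j).2.2.1) j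
    have h1 := φ.realize_rel hs P
    rw [idAt_rho_iff.1 hPQ A hA e] at h1
    exact φ.trans h1 (φ.symm (φ.realize_rel hs Q))
  have hρ' : ∀ P Q, IdAt.{u, v, w} V (rhoStar t (vars L n)) P Q →
      φ'.r (P.realize e) (Q.realize e) := fun P Q hPQ => by
    have hs : ∀ i, φ'.r (e i) (rhoStar t e i) := by
      intro i
      cases i with
      | ys j =>
        exact recY_rel (φ'.refl _) (φ'.refl _) (φ'.refl _) (φ'.refl _) (fun j => (h j).2.2.2) j
      | _ => exact φ'.refl _
    have h1 := φ'.realize_rel hs P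
    rw [idAt_rhoStar_iff.1 hPQ A hA e] at h1
    exact φ'.trans h1 (φ'.symm (φ'.realize_rel hs Q))
  have heq : ∀ m α, IsWord (2 * k) α → 0 < α.length → α.length + m = 2 * k →
      (Lt α).realize e = (Rt α).realize e := by
    intro m
    induction m with
    | zero =>
      intro α hα _ hm
      exact hφ.eq (hρ _ _ (M.full_rho α hα hm)) (hρ' _ _ (M.full_rhoStar α hα hm))
    | succ m ih =>
      intro α hα h0 hm
      have hlt : α.length < 2 * k := by omega
      have hstep : ∀ j, 1 ≤ j → j ≤ 2 * k →
          (Lt (α ++ [j])).realize e = (Rt (α ++ [j])).realize e := fun j hj hj' =>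
        ih _ (fun i hi => (List.mem_append.1 hi).elim (hα i) fun hi =>
          List.mem_singleton.1 hi ▸ ⟨hj, hj'⟩) (by simp) (by simp; omega)
      rcases Nat.even_or_odd α.length with hev | hodd
      · refine hφ.eq (φ.rel_of_links (i := 1) (m := k) hk
          (hρ _ _ (M.even_rho_first α hα h0 hlt hev)) (fun j h1 h2 => hstep j h1 (by omega))
          (fun j h1 h2 => hρ _ _ (M.even_rho_step α hα h0 hlt hev j h1 h2))
          (hρ _ _ (M.even_rho_last α hα h0 hlt hev)))
          (φ'.rel_of_links (i := k + 1) (m := 2 * k) (by omega)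
          (hρ' _ _ (M.even_rhoStar_first α hα h0 hlt hev))
          (fun j h1 h2 => hstep j (by omega) h2)
          (fun j h1 h2 => hρ' _ _ (M.even_rhoStar_step α hα h0 hlt hev j h1 h2))
          (hρ' _ _ (M.even_rhoStar_last α hα h0 hlt hev)))
      · refine hθ.eq (θ.rel_of_links (i := 1) (m := k) hk
          (hσ _ _ (M.odd_sigma_first α hα h0 hlt hodd)) (fun j h1 h2 => hstep j h1 (by omega))
          (fun j h1 h2 => hσ _ _ (M.odd_sigma_step α hα h0 hlt hodd j h1 h2))
          (hσ _ _ (M.odd_sigma_last α hα h0 hlt hodd)))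
          (θ'.rel_of_links (i := k + 1) (m := 2 * k) (by omega)
          (hσ' _ _ (M.odd_sigmaStar_first α hα h0 hlt hodd))
          (fun j h1 h2 => hstep j (by omega) h2)
          (fun j h1 h2 => hσ' _ _ (M.odd_sigmaStar_step α hα h0 hlt hodd j h1 h2))
          (hσ' _ _ (M.odd_sigmaStar_last α hα h0 hlt hodd)))
  have hx : a = (Lt []).realize e := M.empty_left A hA e
  have hy : b = (Rt []).realize e := M.empty_right A hA e
  rw [hx, hy]
  exact φ.rel_of_links (l := fun j => (Lt [j]).realize e) (r := fun j => (Rt [j]).realize e)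
    (i := 1) (m := 2 * k) (by omega) (hρ _ _ M.empty_rho_first)
    (fun j h1 h2 => heq (2 * k - 1) [j] (fun i hi => List.mem_singleton.1 hi ▸ ⟨h1, h2⟩)
      (by simp) (by simp; omega))
    (fun j h1 h2 => hρ _ _ (M.empty_rho_step j h1 h2)) (hρ _ _ M.empty_rho_last)

end Sufficiency

/-! ### Trees of elements indexed by words -/

section Trees

variable {L : FirstOrder.Language.{u, v}} {A : Type*} [L.Structure A]

/-- The pairs `(Lt (α ++ [j]), Rt (α ++ [j]))` with `lo ≤ j ≤ hi` link `Lt α` to `Rt α` by means of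
the relation `S`. -/
structure Linked (S : A → A → Prop) (lo hi : ℕ) (Lt Rt : List ℕ → A) (α : List ℕ) : Prop where
  first : S (Lt α) (Lt (α ++ [lo]))
  step : ∀ j, lo ≤ j → j + 1 ≤ hi → S (Rt (α ++ [j])) (Lt (α ++ [j + 1]))
  last : S (Rt (α ++ [hi])) (Rt α)

/-- The pairs `(Lt α, Rt α)`, for words `α` of length at most `m`, witness the membership of the
root pair in `Level S T k m`. -/
structure IsTree (S T : ℕ → Cong L A) (k m : ℕ) (Lt Rt : List ℕ → A) : Prop where
  leaf : ∀ α, IsWord (2 * k) α → α.length = m →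
    (S 0).r (Lt α) (Rt α) ∧ (T 0).r (Lt α) (Rt α)
  node : ∀ α i, IsWord (2 * k) α → α.length + (i + 1) = m →
    Linked (S (i + 1)).r 1 k Lt Rt α ∧ Linked (T (i + 1)).r (k + 1) (2 * k) Lt Rt α

/-- The family with root `a` and subfamilies `F j`. -/
def graft (a : A) (F : ℕ → List ℕ → A) : List ℕ → A
  | [] => a
  | j :: α => F j α

theorem Level.exists_isTree {S T : ℕ → Cong L A} {k m : ℕ} {a b : A}
    (h : Level S T (k + 1) m a b) :
    ∃ Lt Rt : List ℕ → A, Lt [] = a ∧ Rt [] = b ∧ IsTree S T (k + 1) m Lt Rt := by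
  induction m generalizing a b with
  | zero =>
    refine ⟨fun _ => a, fun _ => b, rfl, rfl, fun α _ _ => h, fun α i _ hi => ?_⟩
    omega
  | succ m ih =>
    obtain ⟨l, r, h1, h2, h3, h4⟩ := h.1.exists_points
    obtain ⟨l', r', h1', h2', h3', h4'⟩ := h.2.exists_points
    -- The letters `1, …, k + 1` carry the first chain, `k + 2, …, 2 (k + 1)` the second one.
    have H : ∀ j, ∃ Lt Rt : List ℕ → A, 1 ≤ j → j ≤ 2 * (k + 1) →
        Lt [] = (if j ≤ k + 1 then l j else l' (j - (k + 1))) ∧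
        Rt [] = (if j ≤ k + 1 then r j else r' (j - (k + 1))) ∧ IsTree S T (k + 1) m Lt Rt := by
      intro j
      by_cases hj : 1 ≤ j ∧ j ≤ 2 * (k + 1)
      · split_ifs with hjk
        · obtain ⟨F, G, hFG⟩ := ih (h2 j hj.1 hjk)
          exact ⟨F, G, fun _ _ => hFG⟩
        · obtain ⟨F, G, hFG⟩ := ih (h2' (j - (k + 1)) (by omega) (by omega))
          exact ⟨F, G, fun _ _ => hFG⟩
      · exact ⟨fun _ => a, fun _ => b, fun h h' => absurd ⟨h, h'⟩ hj⟩
    choose F G hFG using H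
    have hl : ∀ j, 1 ≤ j → j ≤ k + 1 → F j [] = l j ∧ G j [] = r j := fun j h h' => by
      obtain ⟨e1, e2, -⟩ := hFG j h (by omega)
      rw [e1, e2, if_pos h', if_pos h']
      exact ⟨rfl, rfl⟩
    have hl' : ∀ j, 1 ≤ j → j ≤ k + 1 →
        F (k + 1 + j) [] = l' j ∧ G (k + 1 + j) [] = r' j := fun j h h' => by
      obtain ⟨e1, e2, -⟩ := hFG (k + 1 + j) (by omega) (by omega)
      rw [e1, e2, if_neg (by omega), if_neg (by omega), Nat.add_sub_cancel_left]
      exact ⟨rfl, rfl⟩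
    refine ⟨graft a F, graft b G, rfl, rfl, ?_, ?_⟩
    · rintro (_ | ⟨j, α⟩) hα hlen
      · simp at hlen
      · have hj := hα j List.mem_cons_self
        exact (hFG j hj.1 hj.2).2.2.leaf α (fun i hi => hα i (List.mem_cons_of_mem _ hi))
          (by simpa using hlen)
    · rintro (_ | ⟨j, α⟩) i hα hlen
      · obtain rfl : i = m := by simpa using hlen
        refine ⟨⟨?_, fun j hj hj' => ?_, ?_⟩, ⟨?_, fun j hj hj' => ?_, ?_⟩⟩
        · simpa [graft, hl 1 le_rfl (by omega)] using h1
        · simpa [graft, hl j hj (by omega), hl (j + 1) (by omega) hj'] using h3 j hj hj'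
        · simpa [graft, hl (k + 1) (by omega) le_rfl] using h4
        · simpa [graft, hl' 1 le_rfl (by omega)] using h1'
        · obtain ⟨i, rfl⟩ := Nat.exists_eq_add_of_le (Nat.le_of_succ_le hj)
          have e1 := (hl' i (by omega) (by omega)).2
          have e2 := (hl' (i + 1) (by omega) (by omega)).1
          rw [← add_assoc] at e2
          simpa [graft, e1, e2] using h3' i (by omega) (by omega)
        · have e := (hl' (k + 1) (by omega) le_rfl).2
          rw [← two_mul] at e
          simpa [graft, e] using h4'
      · have hj := hα j List.mem_cons_self
        obtain ⟨H1, H2⟩ := (hFG j hj.1 hj.2).2.2.node α i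
          (fun i hi => hα i (List.mem_cons_of_mem _ hi)) (by simp at hlen; omega)
        exact ⟨⟨H1.first, H1.step, H1.last⟩, ⟨H2.first, H2.step, H2.last⟩⟩

/-- The family of pairs extracted from a chain whose links lie in `Level S T`. The subfamilies
below the root are trees. -/
theorem Chain.exists_isTree {S T : ℕ → Cong L A} {ψ : Cong L A} {k m : ℕ} {a b : A}
    (h : Chain ψ.r (Level S T (k + 1) m) (2 * k + 2) a b) :
    ∃ Lt Rt : List ℕ → A, Lt [] = a ∧ Rt [] = b ∧ Linked ψ.r 1 (2 * (k + 1)) Lt Rt [] ∧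
      ∀ j, 1 ≤ j → j ≤ 2 * (k + 1) →
        IsTree S T (k + 1) m (fun α => Lt (j :: α)) (fun α => Rt (j :: α)) := by
  obtain ⟨l, r, h1, h2, h3, h4⟩ := h.exists_points
  have H : ∀ j, ∃ Lt Rt : List ℕ → A, 1 ≤ j → j ≤ 2 * (k + 1) →
      Lt [] = l j ∧ Rt [] = r j ∧ IsTree S T (k + 1) m Lt Rt := by
    intro j
    by_cases hj : 1 ≤ j ∧ j ≤ 2 * (k + 1)
    · obtain ⟨F, G, hFG⟩ := (h2 j hj.1 (by omega)).exists_isTree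
      exact ⟨F, G, fun _ _ => hFG⟩
    · exact ⟨fun _ => a, fun _ => b, fun h h' => absurd ⟨h, h'⟩ hj⟩
  choose F G hFG using H
  refine ⟨graft a F, graft b G, rfl, rfl, ⟨?_, fun j hj hj' => ?_, ?_⟩,
    fun j hj hj' => (hFG j hj hj').2.2⟩
  · change ψ.r a (F 1 [])
    rwa [(hFG 1 (by omega) (by omega)).1]
  · change ψ.r (G j []) (F (j + 1) [])
    rw [(hFG j hj (by omega)).2.1, (hFG (j + 1) (by omega) hj').1]
    exact h3 j hj (by omega)
  · change ψ.r (G (2 * (k + 1)) []) b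
    rwa [(hFG (2 * (k + 1)) (by omega) le_rfl).2.1]

end Trees

/-! ### Witness terms -/

section WitnessTerms

open FirstOrder.Language (HomClass)

open scoped FirstOrder

/-- The terms built from the variables `x, y, z, w` by the operation symbols of `L` and two new
binary symbols `xs`, `ys`. As an `L`-algebra it is absolutely free over `x, y, z, w` and the
elements `xs p q`, `ys p q`; these will be the witnesses required by the pairs `p, q` for two
pairs of congruences to have universal relational products. The universe `w` leaves room for
algebras larger than the language. -/
inductive WitnessTerm (L : FirstOrder.Language.{u, v}) : Type (max u w)
  | x | y | z | w
  | func {l : ℕ} (f : L.Functions l) (ts : Fin l → WitnessTerm L)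
  | xs (p q : WitnessTerm L)
  | ys (p q : WitnessTerm L)

namespace WitnessTerm

variable {L : FirstOrder.Language.{u, v}}

instance : L.Structure (WitnessTerm.{u, v, w} L) where
  funMap f ts := .func f ts
  RelMap _ _ := False

instance : Nonempty (WitnessTerm.{u, v, w} L) := ⟨.x⟩

variable {B : Type*} [L.Structure B]

/-- Recursion on witness terms, with the operations of `L` interpreted in the algebra `B`. -/
def fold (a b c d : B) (X Y : WitnessTerm.{u, v, w} L → WitnessTerm.{u, v, w} L → B → B → B) :
    WitnessTerm.{u, v, w} L → B
  | x => a
  | y => b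
  | z => c
  | w => d
  | func f ts => FirstOrder.Language.Structure.funMap f fun i => fold a b c d X Y (ts i)
  | xs p q => X p q (fold a b c d X Y p) (fold a b c d X Y q)
  | ys p q => Y p q (fold a b c d X Y p) (fold a b c d X Y q)

/-- `fold` as a homomorphism. -/
def foldHom (a b c d : B) (X Y : WitnessTerm.{u, v, w} L → WitnessTerm.{u, v, w} L → B → B → B) :
    WitnessTerm.{u, v, w} L →[L] B where
  toFun := fold a b c d X Y
  map_fun' _ _ := rfl
  map_rel' _ _ h := h.elim

/-- The homomorphism with prescribed values at the free generators (the values of `e` at other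
elements play no role). -/
def eval (e : WitnessTerm.{u, v, w} L → B) : WitnessTerm.{u, v, w} L →[L] B :=
  foldHom (e x) (e y) (e z) (e w) (fun p q _ _ => e (xs p q)) (fun p q _ _ => e (ys p q))

variable (L) in
/-- The substitution `σ`: it identifies `x` with `z`, `y` with `w`, and `xs p q` with `p`. -/
def sigmaHom : WitnessTerm.{u, v, w} L →[L] WitnessTerm.{u, v, w} L :=
  foldHom x y x y (fun _ _ p _ => p) (fun p q _ _ => ys p q)

variable (L) in
/-- The substitution `σ*`: it identifies `x` with `y`, and `xs p q` with `q`. -/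
def sigmaStarHom : WitnessTerm.{u, v, w} L →[L] WitnessTerm.{u, v, w} L :=
  foldHom x x z w (fun _ _ _ q => q) (fun p q _ _ => ys p q)

variable (L) in
/-- The substitution `ρ`: it identifies `z` with `w`, and `ys p q` with `p`. -/
def rhoHom : WitnessTerm.{u, v, w} L →[L] WitnessTerm.{u, v, w} L :=
  foldHom x y z z (fun p q _ _ => xs p q) (fun _ _ p _ => p)

variable (L) in
/-- The substitution `ρ*`: it identifies `ys p q` with `q`. -/
def rhoStarHom : WitnessTerm.{u, v, w} L →[L] WitnessTerm.{u, v, w} L :=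
  foldHom x y z w (fun p q _ _ => xs p q) (fun _ _ _ q => q)

/-- The congruence of those pairs whose images under `h` are identified in all algebras of `V`. -/
def ker (V : Variety L) (h : WitnessTerm.{u, v, w} L →[L] WitnessTerm.{u, v, w} L) :
    Cong L (WitnessTerm.{u, v, w} L) where
  r p q := ∀ (C : Type (max u w)) [L.Structure C], V.Mem C → ∀ e : WitnessTerm.{u, v, w} L → C,
    eval e (h p) = eval e (h q)
  iseqv := ⟨fun _ _ _ _ _ => rfl, fun h C _ hC e => (h C hC e).symm,
    fun h h' C _ hC e => (h C hC e).trans (h' C hC e)⟩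
  funMap_rel n f a b hab C _ hC e := by
    simp only [FirstOrder.Language.HomClass.map_fun]
    exact congrArg _ (funext fun i => hab i C hC e)

variable {V : Variety L} {h : WitnessTerm.{u, v, w} L →[L] WitnessTerm.{u, v, w} L}

theorem ker_of_eq {p q : WitnessTerm.{u, v, w} L} (hpq : h p = h q) : (ker V h).r p q :=
  fun _ _ _ _ => by rw [hpq]

theorem ker_identity {p : L.Term ℕ × L.Term ℕ} (hp : p ∈ V.identities)
    (e : ℕ → WitnessTerm.{u, v, w} L) : (ker V h).r (p.1.realize e) (p.2.realize e) := by
  intro C _ hC e'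
  simp only [← HomClass.realize_term]
  exact hC.2 p hp _

end WitnessTerm

/-! ### Finite systems of witnesses -/

namespace WitnessTerm

variable {L : FirstOrder.Language.{u, v}}

/-- The tuple `(x, y, z, w, xs p₀ q₀, ys p₀ q₀, …)` of generators for a sequence `E` of pairs. -/
def tuple (E : ℕ → WitnessTerm.{u, v, w} L × WitnessTerm.{u, v, w} L) (n : ℕ) :
    Var n → WitnessTerm.{u, v, w} L :=
  mkTuple x y z w (fun i => xs (E i).1 (E i).2) (fun i => ys (E i).1 (E i).2)

/-- The subalgebra generated by `tuple E n`. -/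
def span (E : ℕ → WitnessTerm.{u, v, w} L × WitnessTerm.{u, v, w} L) (n : ℕ) :
    Set (WitnessTerm.{u, v, w} L) :=
  {g | ∃ p : L.Term (Var n), p.realize (tuple E n) = g}

/-- The first `n` pairs of `E` are distinct, and the entries of each of them are generated by the
witnesses of the earlier ones. -/
structure IsSystem (E : ℕ → WitnessTerm.{u, v, w} L × WitnessTerm.{u, v, w} L) (n : ℕ) :
    Prop where
  inj : ∀ i < n, ∀ j < n, E i = E j → i = j
  fst_mem : ∀ i < n, (E i).1 ∈ span E i
  snd_mem : ∀ i < n, (E i).2 ∈ span E i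

variable {E E' : ℕ → WitnessTerm.{u, v, w} L × WitnessTerm.{u, v, w} L} {n n' : ℕ}

theorem span_subset (hn : n ≤ n') (h : ∀ i < n, E' i = E i) : span E n ⊆ span E' n' := by
  rintro _ ⟨p, rfl⟩
  refine ⟨p.relabel (mkTuple .x .y .z .w (fun i => .xs (i.castLE hn)) fun i => .ys (i.castLE hn)),
    ?_⟩
  rw [FirstOrder.Language.Term.realize_relabel]
  congr 1
  funext i
  cases i with
  | xs i => simp [tuple, mkTuple, h i i.isLt]
  | ys i => simp [tuple, mkTuple, h i i.isLt]
  | _ => rfl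

/-- Every system can be prolonged to a system generating `g`. -/
def Reachable (g : WitnessTerm.{u, v, w} L) : Prop :=
  ∀ E n, IsSystem E n → ∃ E' n', n ≤ n' ∧ (∀ i < n, E' i = E i) ∧ IsSystem E' n' ∧ g ∈ span E' n'

theorem exists_system_of_finite {F : Set (WitnessTerm.{u, v, w} L)} (hF : F.Finite)
    (h : ∀ g ∈ F, Reachable g) (hE : IsSystem E n) :
    ∃ E' n', n ≤ n' ∧ (∀ i < n, E' i = E i) ∧ IsSystem E' n' ∧ F ⊆ span E' n' := by
  induction F, hF using Set.Finite.induction_on with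
  | empty => exact ⟨E, n, le_rfl, fun _ _ => rfl, hE, Set.empty_subset _⟩
  | @insert g F _ _ ih =>
    obtain ⟨E1, n1, hn1, h1, hE1, hF1⟩ := ih fun g' hg' => h g' (Set.mem_insert_of_mem _ hg')
    obtain ⟨E2, n2, hn2, h2, hE2, hg⟩ := h g (Set.mem_insert _ _) E1 n1 hE1
    exact ⟨E2, n2, hn1.trans hn2, fun i hi => (h2 i (hi.trans_le hn1)).trans (h1 i hi), hE2,
      Set.insert_subset hg (hF1.trans (span_subset hn2 h2))⟩

theorem exists_system_pair {p q : WitnessTerm.{u, v, w} L} (hp : Reachable p) (hq : Reachable q)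
    (hE : IsSystem E n) :
    ∃ E' n', n ≤ n' ∧ (∀ i < n, E' i = E i) ∧ IsSystem E' n' ∧ ∃ i < n', E' i = (p, q) := by
  obtain ⟨E', n', hn, hEE', hE', hpq⟩ := exists_system_of_finite (F := {p, q}) (Set.toFinite _)
    (by rintro g (rfl | rfl) <;> assumption) hE
  by_cases hex : ∃ i < n', E' i = (p, q)
  · exact ⟨E', n', hn, hEE', hE', hex⟩
  · have hne : ∀ i < n', Function.update E' n' (p, q) i = E' i := fun i hi =>
      Function.update_of_ne hi.ne _ _
    have hself : Function.update E' n' (p, q) n' = (p, q) := Function.update_self _ _ _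
    have hspan : ∀ i ≤ n', span E' i ⊆ span (Function.update E' n' (p, q)) i := fun i hi =>
      span_subset le_rfl fun j hj => hne j (hj.trans_le hi)
    refine ⟨Function.update E' n' (p, q), n' + 1, hn.trans (Nat.le_succ _),
      fun i hi => (hne i (hi.trans_le hn)).trans (hEE' i hi), ⟨?_, ?_, ?_⟩, n', Nat.lt_succ_self _,
      hself⟩
    · intro i hi j hj hij
      rcases Nat.lt_succ_iff_lt_or_eq.1 hi with hi | rfl <;>
        rcases Nat.lt_succ_iff_lt_or_eq.1 hj with hj | rfl
      · rw [hne i hi, hne j hj] at hij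
        exact hE'.inj i hi j hj hij
      · rw [hne i hi, hself] at hij
        exact absurd ⟨i, hi, hij⟩ hex
      · rw [hne j hj, hself] at hij
        exact absurd ⟨j, hj, hij.symm⟩ hex
      · rfl
    · intro i hi
      rcases Nat.lt_succ_iff_lt_or_eq.1 hi with hi | rfl
      · rw [hne i hi]
        exact hspan i hi.le (hE'.fst_mem i hi)
      · rw [hself]
        exact hspan i le_rfl (hpq (Set.mem_insert _ _))
    · intro i hi
      rcases Nat.lt_succ_iff_lt_or_eq.1 hi with hi | rfl
      · rw [hne i hi]
        exact hspan i hi.le (hE'.snd_mem i hi)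
      · rw [hself]
        exact hspan i le_rfl (hpq (Set.mem_insert_of_mem _ rfl))

theorem reachable (g : WitnessTerm.{u, v, w} L) : Reachable g := by
  induction g with
  | x => exact fun E n hE => ⟨E, n, le_rfl, fun _ _ => rfl, hE, .var .x, rfl⟩
  | y => exact fun E n hE => ⟨E, n, le_rfl, fun _ _ => rfl, hE, .var .y, rfl⟩
  | z => exact fun E n hE => ⟨E, n, le_rfl, fun _ _ => rfl, hE, .var .z, rfl⟩
  | w => exact fun E n hE => ⟨E, n, le_rfl, fun _ _ => rfl, hE, .var .w, rfl⟩
  | func f ts ih =>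
    intro E n hE
    obtain ⟨E', n', hn, hEE', hE', hts⟩ := exists_system_of_finite (Set.finite_range ts)
      (by rintro _ ⟨i, rfl⟩; exact ih i) hE
    choose p hp using fun i => hts (Set.mem_range_self i)
    refine ⟨E', n', hn, hEE', hE', .func f p, ?_⟩
    simp only [FirstOrder.Language.Term.realize_func, hp]
    rfl
  | xs p q hp hq =>
    intro E n hE
    obtain ⟨E', n', hn, hEE', hE', i, hi, h⟩ := exists_system_pair hp hq hE
    exact ⟨E', n', hn, hEE', hE', .var (.xs ⟨i, hi⟩), by simp [tuple, mkTuple, h]⟩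
  | ys p q hp hq =>
    intro E n hE
    obtain ⟨E', n', hn, hEE', hE', i, hi, h⟩ := exists_system_pair hp hq hE
    exact ⟨E', n', hn, hEE', hE', .var (.ys ⟨i, hi⟩), by simp [tuple, mkTuple, h]⟩

theorem exists_system {F : Set (WitnessTerm.{u, v, w} L)} (hF : F.Finite) :
    ∃ (E : ℕ → WitnessTerm.{u, v, w} L × WitnessTerm.{u, v, w} L) (n : ℕ),
      IsSystem E n ∧ F ⊆ span E n := by
  obtain ⟨E, n, -, -, hE, h⟩ := exists_system_of_finite (E := fun _ => (x, x)) (n := 0) hF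
    (fun g _ => reachable g) ⟨by simp, by simp, by simp⟩
  exact ⟨E, n, hE, h⟩

theorem IsSystem.tuple_injective (hE : IsSystem E n) : Function.Injective (tuple E n) := by
  intro i j hij
  cases i <;> cases j <;> simp [tuple, mkTuple] at hij ⊢
  all_goals exact Fin.ext (hE.inj _ (Fin.isLt _) _ (Fin.isLt _) (Prod.ext hij.1 hij.2))

variable {C : Type (max u w)} [L.Structure C]

/-- Values at the generators of a system can be prescribed freely. -/
theorem IsSystem.exists_eval (hE : IsSystem E n) (e : Var n → C) :
    ∃ e' : WitnessTerm.{u, v, w} L → C, ∀ i, eval e' (tuple E n i) = e i := by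
  refine ⟨Function.extend (tuple E n) e fun _ => e .x, fun i => ?_⟩
  have h := hE.tuple_injective.extend_apply e (fun _ => e .x) i
  cases i <;> exact h

/-- Along the generators of a system, a homomorphism that identifies each `xs` with the term `s`
required by it satisfies the recursion defining `recX`. -/
theorem recX_eq {s : (i : Fin n) → L.Term (Var i)} (h : WitnessTerm.{u, v, w} L →[L] C)
    {g : ℕ → WitnessTerm.{u, v, w} L} (hs : ∀ i : Fin n, (s i).realize (tuple E i) = g i)
    (hg : ∀ i, h (xs (E i).1 (E i).2) = h (g i)) (j : Fin n) :
    recX s (h x) (h y) (h z) (h w) (fun i => h (ys (E i).1 (E i).2)) j =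
      h (xs (E j).1 (E j).2) := by
  induction j using WellFoundedLT.induction with
  | ind j ih =>
    rw [recX, hg, ← hs j, ← HomClass.realize_term, Function.comp_def, tuple, comp_mkTuple]
    congr 2
    exact funext fun i => ih _ i.isLt

/-- The counterpart of `recX_eq` for the generators `ys`. -/
theorem recY_eq {s : (i : Fin n) → L.Term (Var i)} (h : WitnessTerm.{u, v, w} L →[L] C)
    {g : ℕ → WitnessTerm.{u, v, w} L} (hs : ∀ i : Fin n, (s i).realize (tuple E i) = g i)
    (hg : ∀ i, h (ys (E i).1 (E i).2) = h (g i)) (j : Fin n) :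
    recY s (h x) (h y) (h z) (h w) (fun i => h (xs (E i).1 (E i).2)) j =
      h (ys (E j).1 (E j).2) := by
  induction j using WellFoundedLT.induction with
  | ind j ih =>
    rw [recY, hg, ← hs j, ← HomClass.realize_term, Function.comp_def, tuple, comp_mkTuple]
    congr 2
    exact funext fun i => ih _ i.isLt

/-- If the tuple `τ` is the image of the generators of a system under `h` and an evaluation, then
pairs of terms related modulo `ker V h` have the same value at `τ`. -/
theorem realize_eq_of_ker {V : Variety L} {h : WitnessTerm.{u, v, w} L →[L] WitnessTerm.{u, v, w} L}
    (hC : V.Mem C) {τ : Var n → C} {e' : WitnessTerm.{u, v, w} L → C}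
    (hτ : ∀ i, τ i = eval e' (h (tuple E n i))) {P Q : L.Term (Var n)}
    (hPQ : (ker V h).r (P.realize (tuple E n)) (Q.realize (tuple E n))) :
    P.realize τ = Q.realize τ := by
  have key := hPQ C hC e'
  simp only [← HomClass.realize_term] at key
  rw [funext hτ]
  exact key

variable {V : Variety L} {s : (i : Fin n) → L.Term (Var i)} {P Q : L.Term (Var n)}

theorem IsSystem.idAt_sigma (hE : IsSystem E n)
    (hs : ∀ i : Fin n, (s i).realize (tuple E i) = (E i).1)
    (hPQ : (ker V (sigmaHom L)).r (P.realize (tuple E n)) (Q.realize (tuple E n))) :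
    IdAt.{u, v, w} V (sigma s (vars L n)) P Q := by
  refine idAt_sigma_iff.2 fun C _ hC e => ?_
  obtain ⟨e', he'⟩ := hE.exists_eval e
  obtain rfl : (fun i => eval e' (tuple E n i)) = e := funext he'
  refine realize_eq_of_ker hC (e' := e') (fun i => ?_) hPQ
  cases i with
  | xs j => exact recX_eq ((eval e').comp (sigmaHom L)) (g := fun i => (E i).1) hs (fun _ => rfl) j
  | _ => rfl

theorem IsSystem.idAt_sigmaStar (hE : IsSystem E n)
    (hs : ∀ i : Fin n, (s i).realize (tuple E i) = (E i).2)
    (hPQ : (ker V (sigmaStarHom L)).r (P.realize (tuple E n)) (Q.realize (tuple E n))) :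
    IdAt.{u, v, w} V (sigmaStar s (vars L n)) P Q := by
  refine idAt_sigmaStar_iff.2 fun C _ hC e => ?_
  obtain ⟨e', he'⟩ := hE.exists_eval e
  obtain rfl : (fun i => eval e' (tuple E n i)) = e := funext he'
  refine realize_eq_of_ker hC (e' := e') (fun i => ?_) hPQ
  cases i with
  | xs j =>
    exact recX_eq ((eval e').comp (sigmaStarHom L)) (g := fun i => (E i).2) hs (fun _ => rfl) j
  | _ => rfl

theorem IsSystem.idAt_rho (hE : IsSystem E n)
    (hs : ∀ i : Fin n, (s i).realize (tuple E i) = (E i).1)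
    (hPQ : (ker V (rhoHom L)).r (P.realize (tuple E n)) (Q.realize (tuple E n))) :
    IdAt.{u, v, w} V (rho s (vars L n)) P Q := by
  refine idAt_rho_iff.2 fun C _ hC e => ?_
  obtain ⟨e', he'⟩ := hE.exists_eval e
  obtain rfl : (fun i => eval e' (tuple E n i)) = e := funext he'
  refine realize_eq_of_ker hC (e' := e') (fun i => ?_) hPQ
  cases i with
  | ys j => exact recY_eq ((eval e').comp (rhoHom L)) (g := fun i => (E i).1) hs (fun _ => rfl) j
  | _ => rfl

theorem IsSystem.idAt_rhoStar (hE : IsSystem E n)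
    (hs : ∀ i : Fin n, (s i).realize (tuple E i) = (E i).2)
    (hPQ : (ker V (rhoStarHom L)).r (P.realize (tuple E n)) (Q.realize (tuple E n))) :
    IdAt.{u, v, w} V (rhoStar s (vars L n)) P Q := by
  refine idAt_rhoStar_iff.2 fun C _ hC e => ?_
  obtain ⟨e', he'⟩ := hE.exists_eval e
  obtain rfl : (fun i => eval e' (tuple E n i)) = e := funext he'
  refine realize_eq_of_ker hC (e' := e') (fun i => ?_) hPQ
  cases i with
  | ys j =>
    exact recY_eq ((eval e').comp (rhoStarHom L)) (g := fun i => (E i).2) hs (fun _ => rfl) j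
  | _ => rfl

/-- Equality in the algebra of witness terms yields an identity, as a system is free. -/
theorem IsSystem.models_of_eq (hE : IsSystem E n)
    (h : P.realize (tuple E n) = Q.realize (tuple E n)) : Variety.Models.{u, v, w} V P Q := by
  intro C _ _ e
  obtain ⟨e', he'⟩ := hE.exists_eval e
  have key := congrArg (eval e') h
  simp only [← HomClass.realize_term, Function.comp_def, he'] at key
  exact key

end WitnessTerm

end WitnessTerms

/-! ### From Boolean factor congruences to the identities -/

section Necessity

variable {L : FirstOrder.Language.{u, v}}

theorem finite_setOf_isWord (N m : ℕ) : {α : List ℕ | IsWord N α ∧ α.length ≤ m}.Finite := by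
  refine ((List.finite_length_le (Fin (N + 1)) m).image (List.map Fin.val)).subset ?_
  rintro α ⟨hα, hm⟩
  refine ⟨α.pmap (fun j hj => ⟨j, hj⟩) fun j hj => Nat.lt_succ_of_le (hα j hj).2, by simpa using hm,
    ?_⟩
  simp [List.map_pmap]

open WitnessTerm in
/-- Boolean factor congruences in a suitable quotient of the algebra of witness terms provide a
finite family of witness terms; these live over a finite system of witnesses, hence are given by
terms in finitely many variables. -/
theorem HasBFC.exists_malcevIdentities {V : Variety L} (hV : HasBFC.{u, v, w} V) :
    ∃ (k n : ℕ) (s t : (i : Fin n) → L.Term (Var i)) (Lt Rt : List ℕ → L.Term (Var n)),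
      1 ≤ k ∧ MalcevIdentities.{u, v, w} V k n s t Lt Rt := by
  set θ := ker.{u, v, w} V (sigmaHom L) with hθ
  set θ' := ker.{u, v, w} V (sigmaStarHom L) with hθ'
  set φ := ker.{u, v, w} V (rhoHom L) with hφ
  set φ' := ker.{u, v, w} V (rhoStarHom L) with hφ'
  obtain ⟨k, hk⟩ := exists_chain_of_hasBFC hV θ θ' φ φ'
    (fun p hp e => ⟨ker_identity hp e, ker_identity hp e⟩)
    (fun p q => ⟨xs p q, ker_of_eq rfl, ker_of_eq rfl⟩)
    (fun p q => ⟨ys p q, ker_of_eq rfl, ker_of_eq rfl⟩)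
    (x := x) (y := y) (z := z) (w := w)
    (ker_of_eq rfl) (ker_of_eq rfl) (ker_of_eq rfl) (ker_of_eq rfl)
  obtain ⟨Lt, Rt, hLx, hRy, hroot, htree⟩ := hk.exists_isTree
  set N := 2 * (k + 1) with hN
  -- The information about the family, in terms of the whole word.
  have hleaf : ∀ α, IsWord N α → α.length = N → φ.r (Lt α) (Rt α) ∧ φ'.r (Lt α) (Rt α) := by
    rintro (_ | ⟨j, α⟩) hα hlen
    · simp at hlen
    · have hj := hα j List.mem_cons_self
      exact (htree j hj.1 hj.2).leaf α (fun i hi => hα i (List.mem_cons_of_mem _ hi))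
        (by simp at hlen; omega)
  have hnode : ∀ α, IsWord N α → 0 < α.length → α.length < N →
      Linked (alternate φ θ α.length).r 1 (k + 1) Lt Rt α ∧
      Linked (alternate φ' θ' α.length).r (k + 1 + 1) N Lt Rt α := by
    rintro (_ | ⟨j, α⟩) hα h0 hlen
    · simp at h0
    · have hj := hα j List.mem_cons_self
      simp only [List.length_cons] at hlen ⊢
      obtain ⟨i, hi⟩ := Nat.exists_eq_add_of_lt hlen
      obtain ⟨H1, H2⟩ := (htree j hj.1 hj.2).node α i
        (fun i hi => hα i (List.mem_cons_of_mem _ hi)) (by omega)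
      -- The length of the word and its distance to `N` have the same parity.
      have hpar : Even (i + 1) ↔ Even (α.length + 1) := by
        have : Even (α.length + 1 + (i + 1)) := ⟨k + 1, by omega⟩
        rw [Nat.even_add] at this
        exact this.symm
      have e : ∀ ψ χ : Cong L (WitnessTerm.{u, v, w} L),
          alternate ψ χ (i + 1) = alternate ψ χ (α.length + 1) := fun ψ χ => by
        simp only [alternate, hpar]
      rw [e] at H1 H2
      exact ⟨⟨H1.first, H1.step, H1.last⟩, ⟨H2.first, H2.step, H2.last⟩⟩
  have hfin := finite_setOf_isWord N N
  obtain ⟨E, n, hE, hF⟩ := exists_system ((hfin.image Lt).union (hfin.image Rt))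
  have hLex : ∀ α, ∃ p : L.Term (Var n), IsWord N α → α.length ≤ N →
      p.realize (tuple E n) = Lt α := fun α => by
    by_cases hα : IsWord N α ∧ α.length ≤ N
    · obtain ⟨p, hp⟩ := hF (Or.inl ⟨α, hα, rfl⟩)
      exact ⟨p, fun _ _ => hp⟩
    · exact ⟨.var .x, fun h h' => absurd ⟨h, h'⟩ hα⟩
  have hRex : ∀ α, ∃ p : L.Term (Var n), IsWord N α → α.length ≤ N →
      p.realize (tuple E n) = Rt α := fun α => by
    by_cases hα : IsWord N α ∧ α.length ≤ N
    · obtain ⟨p, hp⟩ := hF (Or.inr ⟨α, hα, rfl⟩)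
      exact ⟨p, fun _ _ => hp⟩
    · exact ⟨.var .x, fun h h' => absurd ⟨h, h'⟩ hα⟩
  choose P hP using hLex
  choose Q hQ using hRex
  choose s hs using fun i : Fin n => hE.fst_mem i i.isLt
  choose t ht using fun i : Fin n => hE.snd_mem i i.isLt
  have hσ : ∀ {p q : L.Term (Var n)} {a b : WitnessTerm.{u, v, w} L},
      p.realize (tuple E n) = a → q.realize (tuple E n) = b → θ.r a b →
        IdAt.{u, v, w} V (sigma s (vars L n)) p q := by
    rintro p q _ _ rfl rfl h
    exact hE.idAt_sigma hs h
  have hσ' : ∀ {p q : L.Term (Var n)} {a b : WitnessTerm.{u, v, w} L},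
      p.realize (tuple E n) = a → q.realize (tuple E n) = b → θ'.r a b →
        IdAt.{u, v, w} V (sigmaStar t (vars L n)) p q := by
    rintro p q _ _ rfl rfl h
    exact hE.idAt_sigmaStar ht h
  have hρ : ∀ {p q : L.Term (Var n)} {a b : WitnessTerm.{u, v, w} L},
      p.realize (tuple E n) = a → q.realize (tuple E n) = b → φ.r a b →
        IdAt.{u, v, w} V (rho s (vars L n)) p q := by
    rintro p q _ _ rfl rfl h
    exact hE.idAt_rho hs h
  have hρ' : ∀ {p q : L.Term (Var n)} {a b : WitnessTerm.{u, v, w} L},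
      p.realize (tuple E n) = a → q.realize (tuple E n) = b → φ'.r a b →
        IdAt.{u, v, w} V (rhoStar t (vars L n)) p q := by
    rintro p q _ _ rfl rfl h
    exact hE.idAt_rhoStar ht h
  have hnil : IsWord N [] := fun j hj => absurd hj List.not_mem_nil
  have happ : ∀ {α j}, IsWord N α → 1 ≤ j → j ≤ N → IsWord N (α ++ [j]) := fun hα hj hj' i hi =>
    (List.mem_append.1 hi).elim (hα i) fun hi => List.mem_singleton.1 hi ▸ ⟨hj, hj'⟩
  have hP' : ∀ {α j}, IsWord N α → α.length < N → 1 ≤ j → j ≤ N →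
      (P (α ++ [j])).realize (tuple E n) = Lt (α ++ [j]) := fun hα hlen hj hj' =>
    hP _ (happ hα hj hj') (by simpa using hlen)
  have hQ' : ∀ {α j}, IsWord N α → α.length < N → 1 ≤ j → j ≤ N →
      (Q (α ++ [j])).realize (tuple E n) = Rt (α ++ [j]) := fun hα hlen hj hj' =>
    hQ _ (happ hα hj hj') (by simpa using hlen)
  have heven : ∀ {α}, IsWord N α → 0 < α.length → α.length < N → Even α.length →
      Linked φ.r 1 (k + 1) Lt Rt α ∧ Linked φ'.r (k + 1 + 1) N Lt Rt α := fun hα h0 hlen h => by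
    have := hnode _ hα h0 hlen
    rwa [alternate_even _ _ h, alternate_even _ _ h] at this
  have hodd : ∀ {α}, IsWord N α → 0 < α.length → α.length < N → Odd α.length →
      Linked θ.r 1 (k + 1) Lt Rt α ∧ Linked θ'.r (k + 1 + 1) N Lt Rt α := fun hα h0 hlen h => by
    have := hnode _ hα h0 hlen
    rwa [alternate_odd _ _ h, alternate_odd _ _ h] at this
  refine ⟨k + 1, n, s, t, P, Q, by omega, ?_⟩
  constructor
  case full_rho =>
    exact fun α hα hl => hρ (hP α hα hl.le) (hQ α hα hl.le) (hleaf α hα hl).1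
  case full_rhoStar =>
    exact fun α hα hl => hρ' (hP α hα hl.le) (hQ α hα hl.le) (hleaf α hα hl).2
  case empty_left =>
    exact hE.models_of_eq (((hP [] hnil (Nat.zero_le _)).trans hLx).symm)
  case empty_right =>
    exact hE.models_of_eq (((hQ [] hnil (Nat.zero_le _)).trans hRy).symm)
  case empty_rho_first =>
    exact hρ (hP [] hnil (Nat.zero_le _))
      (hP' (α := []) hnil (by simp; omega) le_rfl (by omega)) hroot.first
  case empty_rho_step =>
    exact fun j hj hj' => hρ (hQ' (α := []) hnil (by simp; omega) hj (by omega))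
      (hP' (α := []) hnil (by simp; omega) (by omega) hj') (hroot.step j hj hj')
  case empty_rho_last =>
    exact hρ (hQ' (α := []) hnil (by simp; omega) (by omega) le_rfl)
      (hQ [] hnil (Nat.zero_le _)) hroot.last
  case even_rho_first =>
    exact fun α hα h0 hl h => hρ (hP α hα hl.le) (hP' hα hl (by omega) (by omega))
      (heven hα h0 hl h).1.first
  case even_rho_step =>
    exact fun α hα h0 hl h j hj hj' => hρ (hQ' hα hl (by omega) (by omega))
      (hP' hα hl (by omega) (by omega)) ((heven hα h0 hl h).1.step j hj hj')
  case even_rho_last =>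
    exact fun α hα h0 hl h => hρ (hQ' hα hl (by omega) (by omega)) (hQ α hα hl.le)
      (heven hα h0 hl h).1.last
  case even_rhoStar_first =>
    exact fun α hα h0 hl h => hρ' (hP α hα hl.le) (hP' hα hl (by omega) (by omega))
      (heven hα h0 hl h).2.first
  case even_rhoStar_step =>
    exact fun α hα h0 hl h j hj hj' => hρ' (hQ' hα hl (by omega) (by omega))
      (hP' hα hl (by omega) (by omega)) ((heven hα h0 hl h).2.step j hj hj')
  case even_rhoStar_last =>
    exact fun α hα h0 hl h => hρ' (hQ' hα hl (by omega) (by omega)) (hQ α hα hl.le)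
      (heven hα h0 hl h).2.last
  case odd_sigma_first =>
    exact fun α hα h0 hl h => hσ (hP α hα hl.le) (hP' hα hl (by omega) (by omega))
      (hodd hα h0 hl h).1.first
  case odd_sigma_step =>
    exact fun α hα h0 hl h j hj hj' => hσ (hQ' hα hl (by omega) (by omega))
      (hP' hα hl (by omega) (by omega)) ((hodd hα h0 hl h).1.step j hj hj')
  case odd_sigma_last =>
    exact fun α hα h0 hl h => hσ (hQ' hα hl (by omega) (by omega)) (hQ α hα hl.le)
      (hodd hα h0 hl h).1.last
  case odd_sigmaStar_first =>
    exact fun α hα h0 hl h => hσ' (hP α hα hl.le) (hP' hα hl (by omega) (by omega))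
      (hodd hα h0 hl h).2.first
  case odd_sigmaStar_step =>
    exact fun α hα h0 hl h j hj hj' => hσ' (hQ' hα hl (by omega) (by omega))
      (hP' hα hl (by omega) (by omega)) ((hodd hα h0 hl h).2.step j hj hj')
  case odd_sigmaStar_last =>
    exact fun α hα h0 hl h => hσ' (hQ' hα hl (by omega) (by omega)) (hQ α hα hl.le)
      (hodd hα h0 hl h).2.last

end Necessity

end BFC

theorem mainTheorem2 (L : FirstOrder.Language.{u, v}) [L.IsAlgebraic]
    (V : BFC.Variety L) :
    BFC.HasBFC.{u, v, w} V ↔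
      ∃ (k n : ℕ) (s t : (i : Fin n) → L.Term (BFC.Var i))
        (Lt Rt : List ℕ → L.Term (BFC.Var n)),
        1 ≤ k ∧ BFC.MalcevIdentities.{u, v, w} V k n s t Lt Rt := by
  refine ⟨fun hV => hV.exists_malcevIdentities, ?_⟩
  rintro ⟨k, n, s, t, Lt, Rt, hk, M⟩ A _ hA
  exact (M.factorTransfer hk hA).exists_sublattice
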